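/- Let $\ell\ge 4$ and let $(\ell_\mu\ge\dots\ge\ell_1)$ be a partition of $\ell$ with an even number $\mu$ of parts. Let $K$ be the $2\ell\times2\ell$ matrix with ones on the anti-diagonal and zeroes elsewhere, let $G=\mathrm{SO}_{2\ell}(\mathbb C)=\{g : g=(Kg^{-1}K)^T,\ \det g=1\}$, with diagonal torus $A$. Identify $X_*(A)$ with $\mathbb Z^\ell$ by $\lambda(t)=\mathrm{Diag}(t^{\lambda_1},\dots,t^{\lambda_\ell},t^{-\lambda_\ell},\dots,t^{-\lambda_1})$, and $V = X_*(A)\otimes\mathbb R$ with $\mathbb R^\ell$. The simple roots are $\gamma_k=e_k-e_{k+1}$ ($1\le k<\ell$) and $\gamma_\ell=e_{\ell-1}+e_\ell$; let $\check\mu_1,\dots,\check\mu_\ell\in V$ be the dual basis of fundamental coweights, let $\gamma_0=1-(e_1+e_2)$ be the affine simple root, and let $b_{0}=b_{1}=b_{\ell-1}=b_{\ell}=1$ and $b_{k}=2$ for $2\le k\le\ell-2$. Let $C=\{v\in V : 0<\alpha(v)<1 \text{ for all positive roots }\alpha\}$ be the fundamental alcove. A Kac diagram of an element $g\in G$ of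 finite order $m'$, with respect to a primitive $m'$-th root of unity $\xi$, is the labelling of the nodes $\gamma_0,\dots,\gamma_\ell$ of the affine Dynkin diagram obtained as follows: choose $h\in G$ and $\lambda\in X_*(A)$ such that $h^{-1}gh=\lambda(\xi)$ and $\lambda/m'\in\overline{C}$, write $\lambda/m'=\frac1{m'}\sum_{k=1}^{\ell}s_k\check\mu_k$ and $m'=\sum_{k=0}^{\ell}s_kb_k$ with integers $s_k\ge0$, divide all the $s_k$ by their greatest common divisor, and put the resulting integers on the nodes $\gamma_k$. For $1\le k\le\ell$ let $t_k$ be the permutation matrix of the transposition $(k,\,2\ell-k+1)$, for $1\le k<\ell$ let $s_k$ be the permutation matrix of $(k,\,k+1)(2\ell-k,\,2\ell-k+1)$, put $\ell'_\nu=\ell_1+\dots+\ell_{\nu-1}$, and let $$n_{\vec\ell}=\prod_{\nu=1}^{\mu}\bigl(s_{\ell'_\nu+1}s_{\ell'_\nu+2}\cdots s_{\ell'_\nu+\ell_\nu-1}\,t_{\ell'_\nu+\ell_\nu}\bigr)$$ (factors in the order $\nu=1,\dots,\mu$). Put $m=2\,\mathrm{lcm}(\ell_1,\dots,\ell_\mu)$,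 and let $\sigma_1\ge\sigma_2\ge\dots\ge\sigma_\ell$ be the decreasing rearrangement of the list that consists of the numbers $a_\nu m/(2\ell_\nu)$ ($1\le\nu\le\mu$, $1\le a_\nu\le\ell_\nu-1$), $\mu/2$ copies of $m/2$ and $\mu/2$ zeroes. Then $n_{\vec\ell}$ is an element of finite order of $G$ and, for every primitive root of unity $\xi$ whose order is the order of $n_{\vec\ell}$, it has exactly one Kac diagram. Up to division of all labels by their greatest common divisor, this diagram has the label $m-(\sigma_1+\sigma_2)$ on $\gamma_0$, the label $\sigma_k-\sigma_{k+1}$ on $\gamma_k$ for $1\le k\le\ell-1$, and the label $\sigma_{\ell-1}+\sigma_\ell$ on $\gamma_\ell$. (The nodes $\gamma_0,\gamma_1$ form one fork of the diagram, both joined to $\gamma_2$, and $\gamma_{\ell-1},\gamma_\ell$ form the other, both joined to $\gamma_{\ell-2}$.) -/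

import Mathlib

open Matrix

namespace KacD

/-! ### The group `SO_{2ℓ}` and its diagonal torus -/

/-- The square matrix with ones on the anti-diagonal and zeroes elsewhere. -/
def antiDiag (n : ℕ) : Matrix (Fin n) (Fin n) ℂ :=
  Matrix.of fun i j => if j = Fin.rev i then 1 else 0

/-- `SO_{2ℓ}(ℂ)`, realized as the matrices with `g = (K g⁻¹ K)ᵀ` and `det g = 1`. -/
def SO (ℓ : ℕ) : Set (Matrix (Fin (2 * ℓ)) (Fin (2 * ℓ)) ℂ) :=
  {g | g = (antiDiag (2 * ℓ) * g⁻¹ * antiDiag (2 * ℓ))ᵀ ∧ g.det = 1}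

/-- The value at `z` of the cocharacter `lam ∈ ℤ^ℓ = X_*(A)` of the diagonal torus `A`:
`Diag(z^{lam_1}, …, z^{lam_ℓ}, z^{-lam_ℓ}, …, z^{-lam_1})`. -/
noncomputable def cochar {ℓ : ℕ} (lam : Fin ℓ → ℤ) (z : ℂ) :
    Matrix (Fin (2 * ℓ)) (Fin (2 * ℓ)) ℂ :=
  Matrix.diagonal fun i =>
    if h : (i : ℕ) < ℓ then z ^ lam ⟨i, h⟩
    else z ^ (-lam ⟨2 * ℓ - 1 - i, by omega⟩)

/-! ### The root system, the alcove and the fundamental coweights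

`V = X_*(A) ⊗ ℝ` is `ℝ^ℓ`, and roots are paired with it by the dot product. The entry `i : Fin ℓ`
is the coordinate number `i + 1`. -/

/-- The standard basis vector `e_{i+1}` of `ℝ^ℓ`. -/
def e {ℓ : ℕ} (i : Fin ℓ) : Fin ℓ → ℝ := Pi.single i 1

/-- The positive roots `e_i ± e_j` (`i < j`) of `D_ℓ`. -/
def posRoots (ℓ : ℕ) : Set (Fin ℓ → ℝ) :=
  {α | ∃ i j : Fin ℓ, i < j ∧ (α = e i - e j ∨ α = e i + e j)}

/-- The simple roots: `simpleRoot k` is `α_{k+1}`, that is `e_{k+1} - e_{k+2}` if `k + 1 < ℓ`,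
and `e_{ℓ-1} + e_ℓ` if `k + 1 = ℓ`. -/
def simpleRoot {ℓ : ℕ} (k : Fin ℓ) : Fin ℓ → ℝ :=
  if h : (k : ℕ) + 1 < ℓ then e k - e ⟨k + 1, h⟩ else e ⟨k - 1, by omega⟩ + e k

/-- The fundamental alcove `C`: the connected component of the complement of all hyperplanes
`⟨α, v⟩ = n` (`α` a root, `n ∈ ℤ`) which lies in the dominant chamber and has the origin in its
closure. -/
def alcove (ℓ : ℕ) : Set (Fin ℓ → ℝ) :=
  {v | ∀ α ∈ posRoots ℓ, 0 < α ⬝ᵥ v ∧ α ⬝ᵥ v < 1}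

/-- The fundamental coweights: `coweight k` is the coweight dual to the simple root `α_{k+1}`. -/
noncomputable def coweight {ℓ : ℕ} (k : Fin ℓ) : Fin ℓ → ℝ := fun i =>
  if (k : ℕ) + 2 < ℓ then (if i ≤ k then 1 else 0)
  else if (k : ℕ) + 2 = ℓ ∧ (i : ℕ) + 1 = ℓ then -(1 / 2) else 1 / 2

/-- The labels `b_γ` of the affine Dynkin diagram with nodes `γ_0, γ_1, …, γ_ℓ`: they are `1` on
`γ_0, γ_1, γ_{ℓ-1}, γ_ℓ` and `2` on the other nodes. On `γ_1, …, γ_ℓ` these are the coefficients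
of the highest root with respect to the simple roots. -/
def mark {ℓ : ℕ} (k : Fin (ℓ + 1)) : ℕ :=
  if (k : ℕ) ≤ 1 ∨ ℓ ≤ (k : ℕ) + 1 then 1 else 2

theorem simpleRoot_dotProduct_coweight {ℓ : ℕ} (hl : 4 ≤ ℓ) (j k : Fin ℓ) :
    simpleRoot j ⬝ᵥ coweight k = if j = k then 1 else 0 := by
  have hk := k.isLt
  have hj := j.isLt
  unfold simpleRoot
  split_ifs with h1 h2 h2 <;>
    simp only [e, sub_dotProduct, add_dotProduct, single_dotProduct, one_mul, coweight,
      Fin.le_def, Fin.ext_iff] at * <;>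
    split_ifs <;> first | omega | norm_num

theorem highestRoot_dotProduct_coweight {ℓ : ℕ} (hl : 4 ≤ ℓ) (k : Fin ℓ) :
    (e ⟨0, by omega⟩ + e ⟨1, by omega⟩ : Fin ℓ → ℝ) ⬝ᵥ coweight k = mark k.succ := by
  have hk := k.isLt
  simp only [e, add_dotProduct, single_dotProduct, one_mul, coweight, mark,
    Fin.le_def, Fin.val_succ]
  split_ifs <;> first | omega | norm_num

/-! ### Kac diagrams -/

/-- Remove the factors that are common to all labels. -/
def reduce {ℓ : ℕ} (s : Fin (ℓ + 1) → ℤ) : Fin (ℓ + 1) → ℤ :=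
  fun k => s k / Finset.univ.gcd s

/-- `IsKacDiagram ξ g d`: the labelling `d` of the affine Dynkin diagram of type `D_ℓ` (`d k` is
the label of the node `γ_k`) is a Kac diagram of `g ∈ SO_{2ℓ}`. Here `g` has finite order `m`, and
`ξ` is a primitive `m`-th root of unity. There are `h ∈ SO_{2ℓ}` and a cocharacter `lam` of the
torus with `h⁻¹ g h = lam(ξ)`, such that the point `x_g = lam / m` lies in the closure of the
alcove; the nonnegative integers `s_γ` are the coordinates of this point,
`x_g = (1/m) ∑_{γ ≠ γ_0} s_γ μ_γ` and `m = ∑_γ s_γ b_γ`; and `d` is obtained from `s` by removing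
common factors. -/
def IsKacDiagram {ℓ : ℕ} (ξ : ℂ) (g : Matrix (Fin (2 * ℓ)) (Fin (2 * ℓ)) ℂ)
    (d : Fin (ℓ + 1) → ℤ) : Prop :=
  g ∈ SO ℓ ∧ IsOfFinOrder g ∧ IsPrimitiveRoot ξ (orderOf g) ∧
  ∃ h ∈ SO ℓ, ∃ lam : Fin ℓ → ℤ, ∃ x : Fin ℓ → ℝ, ∃ s : Fin (ℓ + 1) → ℤ,
    h⁻¹ * g * h = cochar lam ξ ∧
    (∀ i, x i = (lam i : ℝ) / (orderOf g : ℝ)) ∧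
    x ∈ closure (alcove ℓ) ∧
    (∀ k, 0 ≤ s k) ∧
    x = (1 / (orderOf g : ℝ)) • ∑ k : Fin ℓ, (s k.succ : ℝ) • coweight k ∧
    (orderOf g : ℤ) = ∑ k, s k * (mark k : ℤ) ∧
    d = reduce s

/-! ### The element attached to a partition

Below, `k` and the rows and columns `i + 1`, `j + 1` are counted from `1`. -/

/-- The element `s_k` of `SO_{2ℓ}` (`1 ≤ k < ℓ`). -/
def sMat (ℓ k : ℕ) : Matrix (Fin (2 * ℓ)) (Fin (2 * ℓ)) ℂ :=
  Matrix.of fun i j =>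
    let r : ℕ := i + 1
    let c : ℕ := j + 1
    if (r = c ∧ r ∉ ({k, k + 1, 2 * ℓ - k + 1, 2 * ℓ - k} : Finset ℕ)) ∨
        (r ≠ c ∧ r ∈ ({k, k + 1} : Finset ℕ) ∧ c ∈ ({k, k + 1} : Finset ℕ)) ∨
        (r ≠ c ∧ r ∈ ({2 * ℓ - k, 2 * ℓ - k + 1} : Finset ℕ) ∧
          c ∈ ({2 * ℓ - k, 2 * ℓ - k + 1} : Finset ℕ))
    then 1 else 0

/-- The element `t_k` of `O_{2ℓ}` (`1 ≤ k ≤ ℓ`). -/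
def tMat (ℓ k : ℕ) : Matrix (Fin (2 * ℓ)) (Fin (2 * ℓ)) ℂ :=
  Matrix.of fun i j =>
    let r : ℕ := i + 1
    let c : ℕ := j + 1
    if (r = c ∧ r ∉ ({k, 2 * ℓ - k + 1} : Finset ℕ)) ∨
        (r ≠ c ∧ r ∈ ({k, 2 * ℓ - k + 1} : Finset ℕ) ∧ c ∈ ({k, 2 * ℓ - k + 1} : Finset ℕ))
    then 1 else 0

/-- The product over the parts `a` in a list of the factors
`s_{o+1} s_{o+2} ⋯ s_{o+a-1} t_{o+a}`, where `o` is the sum of the parts already treated. -/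
def blockProd (ℓ : ℕ) : ℕ → List ℕ → Matrix (Fin (2 * ℓ)) (Fin (2 * ℓ)) ℂ
  | _, [] => 1
  | o, a :: as =>
    ((List.range (a - 1)).map fun i => sMat ℓ (o + i + 1)).prod * tMat ℓ (o + a) *
      blockProd ℓ (o + a) as

/-- The element `n` attached to the partition `ℓ_1 ≤ ℓ_2 ≤ ⋯ ≤ ℓ_μ`. -/
def nMat {ℓ : ℕ} (p : Nat.Partition ℓ) : Matrix (Fin (2 * ℓ)) (Fin (2 * ℓ)) ℂ :=
  blockProd ℓ 0 (p.parts.sort (· ≤ ·))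

/-! ### The numbers `σ_k` and the labels built from them -/

/-- `m = 2 lcm(ℓ_1, …, ℓ_μ)`. -/
def mOf {ℓ : ℕ} (p : Nat.Partition ℓ) : ℕ := 2 * p.parts.lcm

/-- The numbers `a m / (2 ℓ_ν)` (`1 ≤ a ≤ ℓ_ν - 1`), with `μ/2` copies of `m/2` and `μ/2` zeroes.
All divisions are exact if `μ` is even. -/
def entries {ℓ : ℕ} (p : Nat.Partition ℓ) : Multiset ℕ :=
  (p.parts.bind fun q => (Finset.Icc 1 (q - 1)).val.map fun a => a * mOf p / (2 * q)) +
    Multiset.replicate (p.parts.card / 2) (mOf p / 2) +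
    Multiset.replicate (p.parts.card / 2) 0

/-- `σ p k` is the `k`-th of these numbers in decreasing order, counted from `k = 1`. -/
def σ {ℓ : ℕ} (p : Nat.Partition ℓ) (k : ℕ) : ℤ :=
  (((entries p).sort (· ≥ ·)).getD (k - 1) 0 : ℕ)

/-- There are exactly `ℓ` of these numbers, so that `σ_1, …, σ_ℓ` are all of them. -/
theorem card_entries {ℓ : ℕ} (p : Nat.Partition ℓ) (hp : Even p.parts.card) :
    (entries p).card = ℓ := by
  have key : ∀ s : Multiset ℕ, (∀ q ∈ s, 0 < q) →
      (s.map fun q => q - 1).sum + s.card = s.sum := by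
    intro s
    induction s using Multiset.induction_on with
    | empty => simp
    | cons a s ih =>
      intro h
      have h1 := ih fun q hq => h q (Multiset.mem_cons_of_mem hq)
      have h2 := h a (Multiset.mem_cons_self a s)
      simp only [Multiset.map_cons, Multiset.sum_cons, Multiset.card_cons]
      omega
  have h := key p.parts fun q hq => p.parts_pos hq
  rw [p.parts_sum] at h
  obtain ⟨c, hc⟩ := hp
  simp only [entries, Multiset.card_add, Multiset.card_bind, Multiset.card_replicate,
    Function.comp_def, Multiset.card_map, Finset.card_val, Nat.card_Icc, Nat.add_sub_cancel]
  omega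

/-- The labels: `m - (σ_1 + σ_2)` on `γ_0`, `σ_k - σ_{k+1}` on `γ_k` for `1 ≤ k ≤ ℓ - 1`, and
`σ_{ℓ-1} + σ_ℓ` on `γ_ℓ`. The nodes `γ_0`, `γ_1` form one fork of the affine Dynkin diagram, and
`γ_{ℓ-1}`, `γ_ℓ` the other one. -/
def sigmaLabels {ℓ : ℕ} (p : Nat.Partition ℓ) : Fin (ℓ + 1) → ℤ := fun k =>
  if (k : ℕ) = 0 then mOf p - (σ p 1 + σ p 2)
  else if (k : ℕ) < ℓ then σ p k - σ p (k + 1)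
  else σ p (ℓ - 1) + σ p ℓ

end KacD

namespace KacD

/-! ### Linear algebra over the complex numbers -/

/-! Write $n$ for the element and $\sigma$ for the cocharacter $(\sigma_1,\dots,\sigma_\ell)$. Each
factor of $n$ is a signed cycle, so $n$ is the matrix of a permutation of $2\ell$ points that
commutes with the reversal $i\mapsto 2\ell+1-i$ and has one cycle of length $2\ell_\nu$ for each
part. Commuting with the reversal makes it orthogonal, evenness of $\mu$ gives determinant $1$, and
its order is $m$ (`exists_perm_nMat`, `nMat_mem_SO`, `orderOf_nMat`).

Its characteristic polynomial is $\prod_\nu(X^{2\ell_\nu}-1)$. Each factor contributes the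
eigenvalues $1$, $-1$ and the inverse pairs $\xi^{\pm a m/(2\ell_\nu)}$. Since $\mu$ is even, the
eigenvalues $1$ and $-1$ also group into $\mu/2$ pairs each, and the result is the characteristic
polynomial of $\sigma(\xi)$ (`charpoly_nMat_eq_cochar`).

Existence: matrices of finite order are diagonalizable, so $n$ and $\sigma(\xi)$ are conjugate in
$\mathrm{GL}$. A polar decomposition makes the conjugating matrix orthogonal
(`exists_orthogonal_conj`). If its determinant is $-1$, it is corrected by a reflection that
centralizes $\sigma(\xi)$, available because $\sigma_\ell=0$. As
$m/2\ge\sigma_1\ge\dots\ge\sigma_\ell\ge 0$, the point $\sigma/m$ lies in the closed alcove.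

Uniqueness: the spectrum determines an admissible $\lambda$ up to permutation, signs and multiples
of $m$. The alcove inequalities leave only the ambiguities $\lambda_\ell\mapsto-\lambda_\ell$ and
$\lambda_1\mapsto m-\lambda_1$, and these are removed because both $0$ and $m/2$ occur among the
$\sigma_k$ (`eq_sigmaVec`). The labels are then read off by pairing with the simple roots and the
highest root (`eq_sigmaLabels_iff`). -/

open Polynomial in
/-- An invertible complex matrix has a square root which is a polynomial in it. -/
theorem exists_aeval_sq_eq {n : Type*} [Fintype n] [DecidableEq n] (S : Matrix n n ℂ)
    (hS : IsUnit S.det) : ∃ q : ℂ[X], aeval S q * aeval S q = S := by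
  set f := S.charpoly with hf
  have hmonic : f.Monic := S.charpoly_monic
  have hsplit : f = (f.roots.map fun a => X - C a).prod :=
    (IsAlgClosed.splits f).eq_prod_roots_of_monic hmonic
  have hf0 : f.coeff 0 ≠ 0 := by
    intro h
    rw [Matrix.det_eq_sign_charpoly_coeff, ← hf, h, mul_zero] at hS
    exact not_isUnit_zero hS

  choose r hr using fun z : ℂ => IsAlgClosed.exists_eq_mul_self z
  -- `q0` is a square root of $X$ at each eigenvalue, hence a square root modulo nilpotents in
  -- $\mathbb C[X]/(f)$.
  let q0 : ℂ[X] := Lagrange.interpolate f.roots.toFinset id r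
  have hq0 : ∀ a ∈ f.roots, q0.eval a ^ 2 = a := by
    intro a ha
    have := Lagrange.eval_interpolate_at_node (s := f.roots.toFinset) (v := id) r
      Function.injective_id.injOn (Multiset.mem_toFinset.2 ha)
    simp only [id] at this
    rw [this, sq, ← hr]
  have hdvd : f ∣ (q0 ^ 2 - X) ^ f.roots.card := by
    have key : ∀ s : Multiset ℂ, (∀ a ∈ s, q0.eval a ^ 2 = a) →
        (s.map fun a => X - C a).prod ∣ (q0 ^ 2 - X) ^ s.card := by
      intro s
      induction s using Multiset.induction_on with
      | empty => simp
      | cons a s ih =>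
        intro h
        rw [Multiset.map_cons, Multiset.prod_cons, Multiset.card_cons, pow_succ']
        refine mul_dvd_mul ?_ (ih fun b hb => h b (Multiset.mem_cons_of_mem hb))
        rw [dvd_iff_isRoot]
        simp [h a (Multiset.mem_cons_self a s)]
    have := key f.roots hq0
    rwa [← hsplit] at this
  have hnil : IsNilpotent (AdjoinRoot.mk f (q0 ^ 2 - X)) :=
    ⟨_, by rw [← map_pow]; exact AdjoinRoot.mk_eq_zero.2 hdvd⟩
  have hroot : IsUnit (AdjoinRoot.mk f X) := by
    have h1 : f = f.divX * X + C (f.coeff 0) := (divX_mul_X_add f).symm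
    have h2 : AdjoinRoot.mk f X * (AdjoinRoot.mk f (f.divX * C (-(f.coeff 0)⁻¹))) = 1 := by
      rw [← map_mul, ← map_one (AdjoinRoot.mk f), AdjoinRoot.mk_eq_mk]
      refine ⟨C (-(f.coeff 0)⁻¹), ?_⟩
      have h3 : (C (f.coeff 0) * C (-(f.coeff 0)⁻¹) : ℂ[X]) = -1 := by
        rw [← C_mul]; simp [hf0]
      linear_combination -C (-(f.coeff 0)⁻¹) * h1 - h3
    exact IsUnit.of_mul_eq_one _ h2
  have hq0u : IsUnit (AdjoinRoot.mk f q0) := by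
    have : IsUnit (AdjoinRoot.mk f q0 ^ 2) := by
      have h := hnil.isUnit_add_left_of_commute hroot (Commute.all _ _)
      simpa using h
    exact (isUnit_pow_iff two_ne_zero).1 this
  -- Newton iteration lifts `q0` to an exact root of $T^2-X$ in $\mathbb C[X]/(f)$; the derivative
  -- $2\,$`q0` is a unit because $0$ is not an eigenvalue. By Cayley–Hamilton the identity then
  -- holds at `S`.
  obtain ⟨t, ⟨-, ht⟩, -⟩ := existsUnique_nilpotent_sub_and_aeval_eq_zero
    (P := (X ^ 2 - C (AdjoinRoot.mk f X) : (AdjoinRoot f)[X])) (x := AdjoinRoot.mk f q0)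
    (by simpa using hnil)
    (by
      have h2 : IsUnit (2 : AdjoinRoot f) := by
        have := (IsUnit.mk0 (2 : ℂ) two_ne_zero).map (algebraMap ℂ (AdjoinRoot f))
        rwa [map_ofNat] at this
      simpa [one_add_one_eq_two] using h2.mul hq0u)
  obtain ⟨q, rfl⟩ := AdjoinRoot.mk_surjective t
  refine ⟨q, ?_⟩
  have ht' : AdjoinRoot.mk f (q ^ 2 - X) = 0 := by simpa using ht
  obtain ⟨c, hc⟩ := AdjoinRoot.mk_eq_zero.1 ht'
  have := congrArg (aeval S) hc
  rw [map_mul, hf, Matrix.aeval_self_charpoly, zero_mul, map_sub, map_pow, aeval_X, sub_eq_zero,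
    sq] at this
  exact this

theorem exists_perm_of_map_univ_eq {n α : Type*} [Fintype n] {f g : n → α}
    (h : Finset.univ.val.map f = Finset.univ.val.map g) : ∃ τ : Equiv.Perm n, ∀ i, f i = g (τ i) := by
  classical
  have hc : ∀ c, Nonempty ({a // f a = c} ≃ {a // g a = c}) := by
    intro c
    rw [← Fintype.card_eq, Fintype.card_subtype, Fintype.card_subtype]
    have := congrArg (Multiset.count c) h
    simp only [Multiset.count_map] at this
    simpa [Finset.card, eq_comm] using this
  refine ⟨Equiv.ofFiberEquiv fun c => (hc c).some, fun i => ?_⟩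
  exact (Equiv.ofFiberEquiv_map (fun c => (hc c).some) i).symm

/-- A complex matrix of finite order is diagonalizable. -/
theorem exists_mul_eq_mul_diagonal {n : Type*} [Fintype n] [DecidableEq n] (M : Matrix n n ℂ)
    {m : ℕ} (hm : m ≠ 0) (hM : M ^ m = 1) :
    ∃ P : Matrix n n ℂ, ∃ d : n → ℂ, IsUnit P.det ∧ M * P = P * diagonal d := by
  have hss : Module.End.IsSemisimple (Matrix.toLin' M) := by
    refine Module.End.isSemisimple_of_squarefree_aeval_eq_zero (p := Polynomial.X ^ m - 1)
      ?_ ?_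
    · exact (Polynomial.X_pow_sub_one_separable_iff.2 (by exact_mod_cast hm)).squarefree
    · simp [← Matrix.toLin'_pow, hM, Module.End.one_eq_id]
  have htop := hss.iSup_eigenspace_eq_top
  let s : Set (n → ℂ) := {v | ∃ μ : ℂ, M *ᵥ v = μ • v}
  have hs : ⊤ ≤ Submodule.span ℂ s := by
    rw [← htop]
    refine iSup_le fun μ => ?_
    intro v hv
    refine Submodule.subset_span ⟨μ, ?_⟩
    simpa using Module.End.mem_eigenspace_iff.1 hv
  let b := Module.Basis.ofSpan hs
  have : Fintype ((linearIndepOn_empty ℂ id).extend (Set.empty_subset s)) :=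
    FiniteDimensional.fintypeBasisIndex b
  let E := b.indexEquiv (Pi.basisFun ℂ n)
  let b' := b.reindex E
  have hb : ∀ i, ∃ μ : ℂ, M *ᵥ b' i = μ • b' i := fun i =>
    Module.Basis.ofSpan_subset hs ⟨E.symm i, by simp [b', b]⟩
  choose d hd using hb
  refine ⟨(Pi.basisFun ℂ n).toMatrix b', d, ?_, ?_⟩
  · have := Module.Basis.toMatrix_mul_toMatrix_flip (Pi.basisFun ℂ n) b'
    exact IsUnit.of_mul_eq_one _ (by rw [← Matrix.det_mul, this, Matrix.det_one])
  · ext i j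
    have := congrFun (hd j) i
    rw [Matrix.mul_diagonal, Matrix.mul_apply]
    simpa [Matrix.mulVec, dotProduct, Module.Basis.toMatrix_apply, mul_comm] using this

/-- A complex matrix of finite order is determined up to conjugation by its characteristic
polynomial. -/
theorem exists_mul_eq_mul_diagonal_of_charpoly_eq {n : Type*} [Fintype n] [DecidableEq n]
    {M : Matrix n n ℂ} {m : ℕ} (hm : m ≠ 0) (hM : M ^ m = 1) {d : n → ℂ}
    (hd : M.charpoly = (diagonal d).charpoly) :
    ∃ P : Matrix n n ℂ, IsUnit P.det ∧ M * P = P * diagonal d := by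
  obtain ⟨P, d', hP, hPd⟩ := exists_mul_eq_mul_diagonal M hm hM
  have hMd : M.charpoly = (diagonal d').charpoly := by
    have hM' : M = P * diagonal d' * P⁻¹ := by
      rw [← hPd, mul_assoc, Matrix.mul_nonsing_inv _ hP, mul_one]
    rw [hM', Matrix.charpoly_mul_comm, ← mul_assoc, Matrix.nonsing_inv_mul _ hP, one_mul]
  have hroots : ∀ d : n → ℂ, (diagonal d).charpoly.roots = Finset.univ.val.map d := by
    intro d
    rw [Matrix.charpoly_diagonal]
    exact Polynomial.roots_multiset_prod_X_sub_C (Finset.univ.val.map d) |> fun h => by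
      simpa [Multiset.map_map] using h
  obtain ⟨τ, hτ⟩ := exists_perm_of_map_univ_eq (f := d) (g := d')
    (by rw [← hroots, ← hroots, ← hd, hMd])
  refine ⟨P.submatrix id τ, ?_, ?_⟩
  · rw [Matrix.det_permute']
    exact IsUnit.mul (by exact_mod_cast ((Equiv.Perm.sign τ).isUnit).map (Int.castRingHom ℂ)) hP
  · ext i j
    have h1 : (M * P.submatrix id τ) i j = (M * P) i (τ j) := by
      simp [Matrix.mul_apply]
    rw [h1, hPd, Matrix.mul_diagonal, Matrix.mul_diagonal, hτ]
    simp

/-- If two matrices preserve a nondegenerate symmetric bilinear form, with Gram matrix `K`, and are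
conjugate, then they are conjugate by a matrix which preserves the form. -/
theorem exists_orthogonal_conj {n : Type*} [Fintype n] [DecidableEq n] {K g D P : Matrix n n ℂ}
    (hKT : Kᵀ = K) (hK : K * K = 1) (hg : K * gᵀ * K * g = 1) (hD : K * Dᵀ * K * D = 1)
    (hP : IsUnit P.det) (hgP : g * P = P * D) :
    ∃ h : Matrix n n ℂ, K * hᵀ * K * h = 1 ∧ g * h = h * D := by
  have hKdet : IsUnit K.det := IsUnit.of_mul_eq_one K.det (by
    rw [← Matrix.det_mul, hK, Matrix.det_one])
  have hadj : ∀ A B : Matrix n n ℂ, K * (A * B)ᵀ * K = K * Bᵀ * K * (K * Aᵀ * K) := by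
    intro A B
    rw [Matrix.transpose_mul]
    calc K * (Bᵀ * Aᵀ) * K = K * Bᵀ * 1 * Aᵀ * K := by simp only [mul_assoc, mul_one]
      _ = _ := by rw [← hK]; simp only [mul_assoc]
  -- With the adjoint $A^*=KA^TK$, this is $S=P^*P$. If $R^2=S$ with $R=R^*$, then $PR^{-1}$
  -- preserves the form, as in a polar decomposition.
  set S := K * Pᵀ * K * P with hS
  have hSdet : IsUnit S.det := by
    rw [hS]
    simp only [Matrix.det_mul, Matrix.det_transpose]
    exact ((hKdet.mul hP).mul hKdet).mul hP
  have hSadj : K * Sᵀ * K = S := by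
    rw [hS, hadj]
    have : K * (K * Pᵀ * K)ᵀ * K = P := by
      simp only [Matrix.transpose_mul, Matrix.transpose_transpose, hKT, mul_assoc, hK, mul_one]
      rw [← mul_assoc, hK, one_mul]
    rw [this]
  have hDinv : D * (K * Dᵀ * K) = 1 := mul_eq_one_comm.1 hD
  have hSD : S * D = D * S := by
    have h1 : K * Pᵀ * K * (K * gᵀ * K) = K * Dᵀ * K * (K * Pᵀ * K) := by
      rw [← hadj, ← hadj, hgP]
    have h2 : K * Pᵀ * K * g = D * (K * Pᵀ * K) := by
      calc K * Pᵀ * K * g = D * (K * Dᵀ * K) * (K * Pᵀ * K) * g := by rw [hDinv, one_mul]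
        _ = D * (K * Dᵀ * K * (K * Pᵀ * K)) * g := by simp only [mul_assoc]
        _ = D * (K * Pᵀ * K) * (K * gᵀ * K * g) := by rw [← h1]; simp only [mul_assoc]
        _ = _ := by rw [hg, mul_one]
    rw [hS, mul_assoc, ← hgP, ← mul_assoc, h2, mul_assoc]
  obtain ⟨q, hq⟩ := exists_aeval_sq_eq S hSdet
  set R := Polynomial.aeval S q with hR
  -- Being a polynomial in `S`, the square root inherits self-adjointness and commutation with `D`;
  -- so does its inverse.
  have hpowD : ∀ k, S ^ k * D = D * S ^ k := fun k => (Commute.pow_left hSD k)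
  have hpowadj : ∀ k, K * (S ^ k)ᵀ * K = S ^ k := by
    intro k
    induction k with
    | zero => simp [hK]
    | succ k ih => rw [pow_succ, hadj, ih, hSadj, ← pow_succ', pow_succ]
  have hRD : R * D = D * R := by
    rw [hR, Polynomial.aeval_eq_sum_range, Finset.sum_mul, Finset.mul_sum]
    simp only [Matrix.smul_mul, Matrix.mul_smul, hpowD]
  have hRadj : K * Rᵀ * K = R := by
    rw [hR, Polynomial.aeval_eq_sum_range, Matrix.transpose_sum, Finset.mul_sum, Finset.sum_mul]
    simp only [Matrix.transpose_smul, Matrix.smul_mul, Matrix.mul_smul, hpowadj]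
  clear_value R
  have hRdet : IsUnit R.det := isUnit_of_mul_isUnit_left (y := R.det) (by
    rw [← Matrix.det_mul, hq]; exact hSdet)
  have hRinvD : R⁻¹ * D = D * R⁻¹ := by
    calc R⁻¹ * D = R⁻¹ * D * (R * R⁻¹) := by rw [Matrix.mul_nonsing_inv _ hRdet, mul_one]
      _ = R⁻¹ * (R * D) * R⁻¹ := by rw [hRD]; simp only [mul_assoc]
      _ = _ := by rw [← mul_assoc R⁻¹, Matrix.nonsing_inv_mul _ hRdet, one_mul]
  have hRinvadj : K * R⁻¹ᵀ * K = R⁻¹ := by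
    have h1 : K * R⁻¹ᵀ * K * R = 1 := by
      have h2 := hadj R R⁻¹
      rw [hRadj] at h2
      rw [← h2, Matrix.mul_nonsing_inv _ hRdet, Matrix.transpose_one, mul_one, hK]
    exact (Matrix.inv_eq_left_inv h1).symm
  refine ⟨P * R⁻¹, ?_, ?_⟩
  · rw [hadj, hRinvadj]
    calc R⁻¹ * (K * Pᵀ * K) * (P * R⁻¹) = R⁻¹ * S * R⁻¹ := by rw [hS]; simp only [mul_assoc]
      _ = R⁻¹ * R * (R * R⁻¹) := by rw [← hq]; simp only [mul_assoc]
      _ = 1 := by rw [Matrix.nonsing_inv_mul _ hRdet, Matrix.mul_nonsing_inv _ hRdet, mul_one]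
  · rw [← mul_assoc, hgP, mul_assoc, mul_assoc, hRinvD]

/-! ### Characteristic polynomial and order of a permutation matrix -/

section PermMatrix
variable {n : Type*} [DecidableEq n]

theorem permMatrix_apply (τ : Equiv.Perm n) (i j : n) :
    τ.permMatrix ℂ i j = if τ i = j then 1 else 0 := by
  simp [PEquiv.toMatrix_apply, eq_comm]

variable [Fintype n]

theorem permMatrix_pow (τ : Equiv.Perm n) (k : ℕ) :
    (τ ^ k).permMatrix ℂ = τ.permMatrix ℂ ^ k := by
  induction k with
  | zero => simp
  | succ k ih => rw [pow_succ, permMatrix_mul, ih, ← pow_succ']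

-- Apply Cayley–Hamilton to the row of one point $a$. With $N$ points, the points $\tau^k a$ for
-- $k<N$ are distinct and $\tau^N a=a$, so the relation forces every coefficient.
open Polynomial in
theorem charpoly_permMatrix_of_isCycleOn {τ : Equiv.Perm n} [Nonempty n]
    (hτ : τ.IsCycleOn (Finset.univ : Finset n)) :
    (τ.permMatrix ℂ).charpoly = X ^ Fintype.card n - 1 := by
  set f := (τ.permMatrix ℂ).charpoly with hf
  have hdeg : f.natDegree = Fintype.card n := Matrix.charpoly_natDegree_eq_dim _
  have hmonic : f.coeff (Fintype.card n) = 1 := by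
    rw [← hdeg]; exact Matrix.charpoly_monic _
  have hN : 0 < Fintype.card n := Fintype.card_pos
  let a : n := Classical.arbitrary n
  have hz : ∀ b, ∑ k ∈ Finset.range (Fintype.card n + 1),
      f.coeff k * (if (τ ^ k) a = b then 1 else 0) = 0 := by
    intro b
    have h := Matrix.aeval_self_charpoly (τ.permMatrix ℂ)
    rw [← hf, Polynomial.aeval_eq_sum_range, hdeg] at h
    have h := congrFun (congrFun h a) b
    simpa only [Matrix.sum_apply, Matrix.smul_apply, ← permMatrix_pow, permMatrix_apply,
      smul_eq_mul, Matrix.zero_apply] using h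
  have hc : ∀ j < Fintype.card n, f.coeff j + (if j = 0 then 1 else 0) = 0 := by
    intro j hj
    refine Eq.trans ?_ (hz ((τ ^ j) a))
    rw [Finset.sum_range_succ, hmonic]
    congr 1
    · rw [Finset.sum_eq_single j]
      · simp
      · intro k hk hkj
        rw [if_neg, mul_zero]
        rw [hτ.pow_apply_eq_pow_apply (Finset.mem_univ a), Finset.card_univ]
        intro h
        exact hkj (h.eq_of_lt_of_lt (Finset.mem_range.1 hk) hj)
      · intro h; exact absurd (Finset.mem_range.2 hj) h
    · rw [one_mul]
      congr 1
      rw [hτ.pow_apply_eq_pow_apply (Finset.mem_univ a), Finset.card_univ, eq_iff_iff]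
      constructor
      · rintro rfl
        simp [Nat.ModEq]
      · intro h
        unfold Nat.ModEq at h
        rw [Nat.mod_self, Nat.mod_eq_of_lt hj] at h
        exact h.symm
  ext j
  rw [coeff_sub, coeff_X_pow, coeff_one]
  rcases lt_trichotomy j (Fintype.card n) with h | h | h
  · rw [if_neg h.ne, zero_sub, eq_neg_iff_add_eq_zero]
    exact hc j h
  · subst h
    rw [if_pos rfl, if_neg hN.ne', sub_zero, hmonic]
  · rw [if_neg h.ne', if_neg (by omega), sub_zero, coeff_eq_zero_of_natDegree_lt (hdeg ▸ h)]

-- The matrix splits into blocks for the moved and the fixed points; on the moved points the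
-- permutation is transitive.
open Polynomial in
theorem charpoly_permMatrix_of_isCycle {τ : Equiv.Perm n} (hτ : τ.IsCycle) :
    (τ.permMatrix ℂ).charpoly =
      (X ^ τ.support.card - 1) * (X - 1) ^ (Fintype.card n - τ.support.card) := by
  have hp' : ∀ i, τ (τ i) ≠ τ i ↔ τ i ≠ i := fun i => by simp
  let τ' : Equiv.Perm {i // τ i ≠ i} := τ.subtypePerm hp'
  unfold Matrix.charpoly
  rw [Matrix.twoBlockTriangular_det _ (fun i => τ i ≠ i)]
  swap
  · intro i hi j hj
    have hij : i ≠ j := by rintro rfl; exact hi hj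
    rw [charmatrix_apply_ne _ _ _ hij, permMatrix_apply, if_neg, map_zero, neg_zero]
    rw [not_not] at hi
    rwa [hi]
  congr 1
  · have h1 : toSquareBlockProp (charmatrix (τ.permMatrix ℂ)) (fun i => τ i ≠ i) =
        charmatrix (τ'.permMatrix ℂ) := by
      ext i j : 2
      rw [toSquareBlockProp_def, Matrix.of_apply]
      by_cases hij : i = j
      · subst hij
        rw [charmatrix_apply_eq, charmatrix_apply_eq, permMatrix_apply, permMatrix_apply]
        simp [τ', Subtype.ext_iff]
      · rw [charmatrix_apply_ne _ _ _ hij, charmatrix_apply_ne _ _ _ (fun h => hij (Subtype.ext h)),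
          permMatrix_apply, permMatrix_apply]
        simp [τ', Subtype.ext_iff]
    obtain ⟨x, hx, -⟩ := id hτ
    have : Nonempty {i // τ i ≠ i} := ⟨⟨x, hx⟩⟩
    have h2 : τ'.IsCycleOn (Finset.univ : Finset {i // τ i ≠ i}) := by
      rw [Finset.coe_univ]
      refine ⟨by simp, ?_⟩
      intro i _ j _
      obtain ⟨k, hk⟩ := hτ.sameCycle i.2 j.2
      refine ⟨k, Subtype.ext ?_⟩
      rw [Equiv.Perm.subtypePerm_zpow]
      exact hk
    rw [h1]
    refine (charpoly_permMatrix_of_isCycleOn h2).trans ?_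
    rw [Fintype.card_subtype]
    rfl
  · have h1 : toSquareBlockProp (charmatrix (τ.permMatrix ℂ)) (fun i => ¬ τ i ≠ i) =
        diagonal fun _ => (X - 1) := by
      ext i j : 2
      rw [toSquareBlockProp_def, Matrix.of_apply]
      have hi : τ i = i := not_not.1 i.2
      by_cases hij : i = j
      · subst hij
        rw [charmatrix_apply_eq, permMatrix_apply, if_pos hi, diagonal_apply_eq, map_one]
      · have hij' : (i : n) ≠ j := fun h => hij (Subtype.ext h)
        rw [charmatrix_apply_ne _ _ _ hij', permMatrix_apply, hi, if_neg hij',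
          diagonal_apply_ne _ hij, map_zero, neg_zero]
    rw [h1, det_diagonal, Finset.prod_const, Finset.card_univ, Fintype.card_subtype_compl,
      Fintype.card_subtype]
    rfl

-- Disjointness gives $(\pi-1)(\tau-1)=0$ for the matrices, whence
-- $(X-\pi)(X-\tau)=(X-1)(X-\pi\tau)$; take determinants. The order of the matrices is reversed
-- because `permMatrix` is antimultiplicative.
open Polynomial in
theorem charpoly_permMatrix_mul_of_disjoint {τ π : Equiv.Perm n} (h : τ.Disjoint π) :
    (τ.permMatrix ℂ).charpoly * (π.permMatrix ℂ).charpoly =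
      (X - 1) ^ Fintype.card n * ((τ * π).permMatrix ℂ).charpoly := by
  have h1 : (π.permMatrix ℂ - 1) * (τ.permMatrix ℂ - 1) = 0 := by
    have : (τ * π).permMatrix ℂ + 1 = τ.permMatrix ℂ + π.permMatrix ℂ := by
      ext i j
      simp only [Matrix.add_apply, permMatrix_apply, Matrix.one_apply, Equiv.Perm.mul_apply]
      rcases h i with hi | hi
      · have : τ (π i) = π i := by
          rcases h (π i) with h' | h'
          · exact h'
          · rw [π.injective h', hi]
        simp only [this, hi]
        exact add_comm _ _
      · simp only [hi]
    rw [sub_mul, mul_sub, ← permMatrix_mul, one_mul, mul_one]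
    rw [eq_sub_of_add_eq this]
    abel
  have h2 : charmatrix (π.permMatrix ℂ) * charmatrix (τ.permMatrix ℂ) =
      (X - 1 : ℂ[X]) • charmatrix ((τ * π).permMatrix ℂ) := by
    have h3 : (C.mapMatrix (π.permMatrix ℂ) - 1 : Matrix n n ℂ[X]) *
        (C.mapMatrix (τ.permMatrix ℂ) - 1) = 0 := by
      rw [← map_one (C.mapMatrix : Matrix n n ℂ →+* Matrix n n ℂ[X]), ← map_sub, ← map_sub,
        ← map_mul, h1, map_zero]
    unfold charmatrix
    rw [permMatrix_mul, map_mul, Matrix.smul_eq_diagonal_mul, ← Matrix.scalar_apply, map_sub,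
      map_one]
    have hc : ∀ A : Matrix n n ℂ[X], A * scalar n X = scalar n X * A := fun A =>
      ((scalar_commute X (fun r => Commute.all _ _) A).symm)
    generalize C.mapMatrix (π.permMatrix ℂ) = A at *
    generalize C.mapMatrix (τ.permMatrix ℂ) = B at *
    have hA := hc A
    generalize (scalar n) (X : ℂ[X]) = s at *
    rw [sub_mul, mul_sub, mul_sub, hA]
    simp only [sub_mul, mul_sub, one_mul, mul_one] at h3 ⊢
    have h4 : A * B = A + B - 1 := by
      rw [← sub_eq_zero, ← h3]
      abel
    rw [h4]
    simp only [mul_sub, mul_add, mul_one]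
    abel
  unfold Matrix.charpoly
  rw [mul_comm, ← det_mul, h2, det_smul]

open Polynomial in
theorem charpoly_permMatrix (τ : Equiv.Perm n) :
    (τ.permMatrix ℂ).charpoly = (τ.cycleType.map fun q => (X ^ q - 1 : ℂ[X])).prod *
      (X - 1) ^ (Fintype.card n - τ.support.card) := by
  induction τ using Equiv.Perm.cycle_induction_on with
  | base_one =>
    rw [permMatrix_one, charpoly_one]
    simp
  | base_cycles τ hτ => rw [charpoly_permMatrix_of_isCycle hτ, hτ.cycleType]; simp
  | induction_disjoint τ π h _ hτ hπ =>
    have hX : (X - 1 : ℂ[X]) ≠ 0 := X_sub_C_ne_zero 1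
    refine mul_left_cancel₀ (pow_ne_zero (Fintype.card n) hX) ?_
    rw [← charpoly_permMatrix_mul_of_disjoint h, hτ, hπ, h.cycleType_mul, Multiset.map_add,
      Multiset.prod_add, h.card_support_mul]
    have h1 : τ.support.card + π.support.card ≤ Fintype.card n := by
      rw [← h.card_support_mul]; exact Finset.card_le_univ _
    have h2 : (X - 1 : ℂ[X]) ^ (Fintype.card n - τ.support.card) *
        (X - 1) ^ (Fintype.card n - π.support.card) = (X - 1) ^ Fintype.card n *
        (X - 1) ^ (Fintype.card n - (τ.support.card + π.support.card)) := by
      rw [← pow_add, ← pow_add]; congr 1; omega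
    linear_combination (τ.cycleType.map fun q => (X ^ q - 1 : ℂ[X])).prod *
      (π.cycleType.map fun q => (X ^ q - 1 : ℂ[X])).prod * h2

theorem orderOf_permMatrix (τ : Equiv.Perm n) : orderOf (τ.permMatrix ℂ) = orderOf τ := by
  refine orderOf_eq_orderOf_iff.2 fun k => ?_
  rw [← permMatrix_pow]
  constructor
  · intro h
    ext i
    have := congrFun (congrFun h i) i
    rw [permMatrix_apply, Matrix.one_apply_eq] at this
    by_contra hne
    rw [Equiv.Perm.one_apply] at hne
    rw [if_neg hne] at this
    exact zero_ne_one this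
  · intro h
    rw [h, permMatrix_one]

end PermMatrix

/-! ### Cycle structure of $n$ -/

/-- Writing the cycle as a list that starts at $y$, left multiplication by the transposition
prepends $x$ to the list. Multiplication on the right follows by passing to inverses. -/
theorem isCycle_mul_swap {α : Type*} [Fintype α] [DecidableEq α] {c : Equiv.Perm α}
    (hc : c.IsCycle) {x y : α} (hy : c y ≠ y) (hx : c x = x) :
    (c * Equiv.swap x y).IsCycle ∧ (c * Equiv.swap x y).support = insert x c.support := by
  have key : ∀ c : Equiv.Perm α, c.IsCycle → c y ≠ y → c x = x →
      (Equiv.swap x y * c).IsCycle ∧ (Equiv.swap x y * c).support = insert x c.support := by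
    intro c hc hy hx
    have h1 : (c.toList y).formPerm = c := by
      rw [Equiv.Perm.formPerm_toList, hc.cycleOf_eq hy]
    have h2 : c.toList y ≠ [] := by
      rw [Ne, Equiv.Perm.toList_eq_nil_iff, Equiv.Perm.mem_support, not_not]
      exact hy
    have h5 := Equiv.Perm.nodup_toList c y
    have h6 : x ∉ c.toList y := by
      rw [Equiv.Perm.mem_toList_iff]
      rintro ⟨h, h'⟩
      have := (Equiv.Perm.SameCycle.apply_eq_self_iff h).2 hx
      exact hy this
    have h7 : (c.toList y).toFinset = c.support := by
      ext z
      rw [List.mem_toFinset, Equiv.Perm.mem_toList_iff, Equiv.Perm.mem_support,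
        Equiv.Perm.mem_support]
      exact ⟨fun h => fun h' => hy ((Equiv.Perm.SameCycle.apply_eq_self_iff h.1).2 h'),
        fun h => ⟨hc.sameCycle hy h, hy⟩⟩
    obtain ⟨z, l, hl⟩ := List.exists_cons_of_ne_nil h2
    have hz : z = y := by
      have h4 := Equiv.Perm.toList_getElem_zero (p := c) (x := y) (Equiv.Perm.mem_support.2 hy)
      simpa only [hl, List.getElem_cons_zero] using h4
    subst hz
    rw [hl] at h1 h5 h6 h7
    have h8 : (x :: z :: l).Nodup := List.nodup_cons.2 ⟨h6, h5⟩
    rw [← h7, ← h1, ← List.formPerm_cons_cons]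
    refine ⟨List.isCycle_formPerm h8 (by simp), ?_⟩
    rw [List.support_formPerm_of_nodup _ h8 (by simp), List.toFinset_cons]
  have hx' : c⁻¹ x = x := by rw [Equiv.Perm.inv_eq_iff_eq, hx]
  have hy' : c⁻¹ y ≠ y := by rw [Ne, Equiv.Perm.inv_eq_iff_eq]; exact fun h => hy h.symm
  have h := key c⁻¹ hc.inv hy' hx'
  have he : Equiv.swap x y * c⁻¹ = (c * Equiv.swap x y)⁻¹ := by
    rw [_root_.mul_inv_rev, Equiv.swap_inv]
  rw [he, Equiv.Perm.support_inv, Equiv.Perm.support_inv, Equiv.Perm.isCycle_inv] at h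
  exact h

theorem sMat_eq_permMatrix {ℓ k : ℕ} (hk : k + 1 < ℓ) :
    sMat ℓ (k + 1) = (Equiv.swap (⟨k, by omega⟩ : Fin (2 * ℓ)) ⟨k + 1, by omega⟩ *
      Equiv.swap (⟨2 * ℓ - 1 - k, by omega⟩ : Fin (2 * ℓ)) ⟨2 * ℓ - 2 - k, by omega⟩).permMatrix ℂ := by
  ext i j
  rw [permMatrix_apply, sMat, Matrix.of_apply]
  refine if_congr ?_ rfl rfl
  have hi := i.isLt
  have hj := j.isLt
  simp only [Equiv.Perm.mul_apply, Equiv.swap_apply_def, Fin.ext_iff, Finset.mem_insert,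
    Finset.mem_singleton]
  split_ifs <;> (try dsimp only at *) <;> omega

theorem tMat_eq_permMatrix {ℓ k : ℕ} (hk : k < ℓ) :
    tMat ℓ (k + 1) = (Equiv.swap (⟨k, by omega⟩ : Fin (2 * ℓ))
      ⟨2 * ℓ - 1 - k, by omega⟩).permMatrix ℂ := by
  ext i j
  rw [permMatrix_apply, tMat, Matrix.of_apply]
  refine if_congr ?_ rfl rfl
  have hi := i.isLt
  have hj := j.isLt
  simp only [Equiv.swap_apply_def, Fin.ext_iff, Finset.mem_insert, Finset.mem_singleton]
  split_ifs <;> (try dsimp only at *) <;> omega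

theorem antiDiag_eq_permMatrix (n : ℕ) :
    antiDiag n = (Fin.revPerm : Equiv.Perm (Fin n)).permMatrix ℂ := by
  ext i j
  rw [permMatrix_apply, antiDiag, Matrix.of_apply]
  exact if_congr eq_comm rfl rfl

theorem swap_apply_rev {n : ℕ} (x y i : Fin n) :
    Equiv.swap x y i.rev = (Equiv.swap x.rev y.rev i).rev := by
  rw [← Fin.rev_injective.swap_apply, Fin.rev_rev, Fin.rev_rev]

/-- The signed cycle attached to one part. -/
theorem exists_perm_block {ℓ : ℕ} (a o : ℕ) (h : o + (a + 1) ≤ ℓ) :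
    ∃ c : Equiv.Perm (Fin (2 * ℓ)),
      ((List.range a).map fun i => sMat ℓ (o + i + 1)).prod * tMat ℓ (o + (a + 1)) =
        c.permMatrix ℂ ∧ c.IsCycle ∧ c.support.card = 2 * (a + 1) ∧
      (∀ i, c i ≠ i ↔ (o ≤ (i : ℕ) ∧ (i : ℕ) ≤ o + a) ∨
        (o ≤ 2 * ℓ - 1 - (i : ℕ) ∧ 2 * ℓ - 1 - (i : ℕ) ≤ o + a)) ∧
      ∀ i, c (Fin.rev i) = Fin.rev (c i) := by
  induction a generalizing o with
  | zero =>
    have hne : (⟨o, by omega⟩ : Fin (2 * ℓ)) ≠ ⟨2 * ℓ - 1 - o, by omega⟩ := by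
      rw [Ne, Fin.ext_iff]; dsimp only; omega
    refine ⟨_, ?_, Equiv.Perm.isCycle_swap hne, Equiv.Perm.card_support_swap hne, ?_, ?_⟩
    · rw [List.range_zero, List.map_nil, List.prod_nil, one_mul, zero_add,
        tMat_eq_permMatrix (by omega)]
    · intro i
      rw [Equiv.swap_apply_ne_self_iff]
      simp only [Fin.ext_iff, add_zero]
      have := i.isLt
      omega
    · intro i
      have := i.isLt
      simp only [Equiv.swap_apply_def, Fin.ext_iff, Fin.val_rev]
      split_ifs <;> (try simp only [Fin.val_rev] at *) <;> omega
  | succ a ih =>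
    -- The leftmost factor $s_{o+1}$ is peeled off. Its two transpositions attach `o` and its mirror
    -- image to the cycle of the remaining block, one after the other.
    obtain ⟨c, h1, h2, h3, h4, h5⟩ := ih (o + 1) (by omega)
    have hx : c (⟨o, by omega⟩ : Fin (2 * ℓ)) = ⟨o, by omega⟩ := by
      rw [← not_not (a := c _ = _), ← Ne, h4]; dsimp only; omega
    have hy : c (⟨o + 1, by omega⟩ : Fin (2 * ℓ)) ≠ ⟨o + 1, by omega⟩ := by
      rw [h4]; dsimp only; omega
    obtain ⟨g1, g2⟩ := isCycle_mul_swap h2 hy hx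
    have hm := fun z => Finset.ext_iff.1 g2 z
    simp only [Equiv.Perm.mem_support, Finset.mem_insert] at hm
    have hx' : (c * Equiv.swap (⟨o, by omega⟩ : Fin (2 * ℓ)) ⟨o + 1, by omega⟩)
        ⟨2 * ℓ - 1 - o, by omega⟩ = ⟨2 * ℓ - 1 - o, by omega⟩ := by
      rw [← not_not (a := _ = _), ← Ne, hm, h4, Fin.ext_iff]; dsimp only; omega
    have hy' : (c * Equiv.swap (⟨o, by omega⟩ : Fin (2 * ℓ)) ⟨o + 1, by omega⟩)
        ⟨2 * ℓ - 2 - o, by omega⟩ ≠ ⟨2 * ℓ - 2 - o, by omega⟩ := by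
      rw [hm, h4, Fin.ext_iff]; dsimp only; omega
    obtain ⟨k1, k2⟩ := isCycle_mul_swap g1 hy' hx'
    have hm' := fun z => Finset.ext_iff.1 k2 z
    simp only [Equiv.Perm.mem_support, Finset.mem_insert] at hm'
    refine ⟨_, ?_, k1, ?_, ?_, ?_⟩
    · rw [List.range_succ_eq_map, List.map_cons, List.prod_cons, List.map_map, mul_assoc,
        mul_assoc, permMatrix_mul, ← sMat_eq_permMatrix (by omega), ← h1]
      have e1 : ((fun i => sMat ℓ (o + i + 1)) ∘ Nat.succ) = fun i => sMat ℓ (o + 1 + i + 1) := by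
        funext i
        simp only [Function.comp_apply, Nat.succ_eq_add_one, add_assoc, add_comm 1 i]
      rw [e1, add_zero, add_assoc o 1, add_comm 1 (a + 1)]
    · rw [k2, Finset.card_insert_of_notMem, g2, Finset.card_insert_of_notMem, h3]
      · ring
      · rw [Equiv.Perm.mem_support, not_not]; exact hx
      · rw [Equiv.Perm.mem_support, not_not]; exact hx'
    · intro i
      have := i.isLt
      rw [hm', hm, h4, Fin.ext_iff, Fin.ext_iff]
      dsimp only
      omega
    · intro i
      rw [mul_assoc, Equiv.Perm.mul_apply, Equiv.Perm.mul_apply c, ← h5]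
      congr 1
      -- The reversal interchanges the two transpositions, which commute because they are disjoint.
      have hd : Equiv.Perm.Disjoint
          (Equiv.swap (⟨o, by omega⟩ : Fin (2 * ℓ)) ⟨o + 1, by omega⟩)
          (Equiv.swap (⟨2 * ℓ - 1 - o, by omega⟩ : Fin (2 * ℓ)) ⟨2 * ℓ - 2 - o, by omega⟩) := by
        refine Equiv.Perm.disjoint_swap_swap ?_
        simp only [List.nodup_cons, List.mem_cons, Fin.ext_iff, List.not_mem_nil, or_false,
          not_false_eq_true, List.nodup_nil, and_true]
        omega
      have e1 : (⟨2 * ℓ - 1 - o, by omega⟩ : Fin (2 * ℓ)) = Fin.rev ⟨o, by omega⟩ := by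
        rw [Fin.ext_iff, Fin.val_rev]; dsimp only; omega
      have e2 : (⟨2 * ℓ - 2 - o, by omega⟩ : Fin (2 * ℓ)) = Fin.rev ⟨o + 1, by omega⟩ := by
        rw [Fin.ext_iff, Fin.val_rev]; dsimp only; omega
      rw [e1, e2] at hd ⊢
      rw [Equiv.Perm.mul_apply, swap_apply_rev, swap_apply_rev, Fin.rev_rev, Fin.rev_rev,
        hd.commute.eq, Equiv.Perm.mul_apply]

theorem exists_perm_blockProd {ℓ : ℕ} (L : List ℕ) (o : ℕ) (hL : ∀ a ∈ L, 0 < a)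
    (h : o + L.sum ≤ ℓ) :
    ∃ π : Equiv.Perm (Fin (2 * ℓ)), blockProd ℓ o L = π.permMatrix ℂ ∧
      π.cycleType = (L.map (2 * ·) : List ℕ) ∧
      (∀ i, π i ≠ i → o ≤ (i : ℕ) ∧ o ≤ 2 * ℓ - 1 - (i : ℕ)) ∧
      ∀ i, π (Fin.rev i) = Fin.rev (π i) := by
  induction L generalizing o with
  | nil => exact ⟨1, by simp [blockProd], by simp, by simp, by simp⟩
  | cons a L ih =>
    obtain ⟨b, rfl⟩ : ∃ b, a = b + 1 := ⟨a - 1, by have := hL a List.mem_cons_self; omega⟩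
    rw [List.sum_cons] at h
    obtain ⟨c, h1, h2, h3, h4, h5⟩ := exists_perm_block (ℓ := ℓ) b o (by omega)
    obtain ⟨π, g1, g2, g3, g4⟩ := ih (o + (b + 1))
      (fun a ha => hL a (List.mem_cons_of_mem _ ha)) (by omega)
    have hd : π.Disjoint c := by
      intro i
      by_contra hne
      rw [not_or] at hne
      have e1 := g3 i hne.1
      have e2 := (h4 i).1 hne.2
      have := i.isLt
      omega
    refine ⟨π * c, ?_, ?_, ?_, ?_⟩
    · rw [blockProd, Nat.add_sub_cancel, h1, g1, permMatrix_mul]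
    · rw [hd.cycleType_mul, g2, h2.cycleType, h3, add_comm]
      rfl
    · intro i hi
      have := i.isLt
      by_cases hc : c i = i
      · rw [Equiv.Perm.mul_apply, hc] at hi
        have := g3 i hi
        omega
      · have := (h4 i).1 hc
        omega
    · intro i
      rw [Equiv.Perm.mul_apply, Equiv.Perm.mul_apply, h5, g4]

theorem exists_perm_nMat {ℓ : ℕ} (p : Nat.Partition ℓ) :
    ∃ π : Equiv.Perm (Fin (2 * ℓ)), nMat p = π.permMatrix ℂ ∧
      π.cycleType = p.parts.map (2 * ·) ∧ ∀ i, π (Fin.rev i) = Fin.rev (π i) := by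
  obtain ⟨π, h1, h2, -, h4⟩ := exists_perm_blockProd (ℓ := ℓ) (p.parts.sort (· ≤ ·)) 0
    (fun a ha => p.parts_pos ((Multiset.mem_sort _).1 ha))
    (by rw [zero_add, ← Multiset.sum_coe, Multiset.sort_eq, p.parts_sum])
  refine ⟨π, h1, ?_, h4⟩
  rw [h2, ← Multiset.map_coe, Multiset.sort_eq]

/-! ### Membership in $\mathrm{SO}_{2\ell}$, order and characteristic polynomial of $n$ -/

theorem antiDiag_transpose (n : ℕ) : (antiDiag n)ᵀ = antiDiag n := by
  rw [antiDiag_eq_permMatrix, transpose_permMatrix]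
  rfl

theorem antiDiag_mul_self (n : ℕ) : antiDiag n * antiDiag n = 1 := by
  rw [antiDiag_eq_permMatrix, ← permMatrix_mul]
  have : (Fin.revPerm * Fin.revPerm : Equiv.Perm (Fin n)) = 1 := by ext i; simp
  rw [this, permMatrix_one]

theorem mem_SO_iff {ℓ : ℕ} (g : Matrix (Fin (2 * ℓ)) (Fin (2 * ℓ)) ℂ) :
    g ∈ SO ℓ ↔ antiDiag (2 * ℓ) * gᵀ * antiDiag (2 * ℓ) * g = 1 ∧ g.det = 1 := by
  set K := antiDiag (2 * ℓ) with hK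
  have hKT : Kᵀ = K := antiDiag_transpose _
  have hKK : K * K = 1 := antiDiag_mul_self _
  refine and_congr_left fun hdet => ?_
  have hu : IsUnit g.det := by rw [hdet]; exact isUnit_one
  constructor
  · intro h
    have h1 : gᵀ = K * g⁻¹ * K := by rw [← transpose_inj, transpose_transpose]; exact h
    rw [h1]
    calc K * (K * g⁻¹ * K) * K * g = (K * K) * g⁻¹ * (K * K) * g := by simp only [mul_assoc]
      _ = 1 := by rw [hKK, one_mul, mul_one, nonsing_inv_mul _ hu]
  · intro h
    have h1 : g⁻¹ = K * gᵀ * K := inv_eq_left_inv h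
    have h2 : K * g⁻¹ * K = gᵀ := by
      rw [h1]
      calc K * (K * gᵀ * K) * K = (K * K) * gᵀ * (K * K) := by simp only [mul_assoc]
        _ = gᵀ := by rw [hKK, one_mul, mul_one]
    rw [h2, transpose_transpose]

/-- The transpose of a permutation matrix is its inverse, so preserving the form amounts to
commuting with the reversal. -/
theorem antiDiag_mul_transpose_permMatrix {n : ℕ} {π : Equiv.Perm (Fin n)}
    (h : ∀ i, π (Fin.rev i) = Fin.rev (π i)) :
    antiDiag n * (π.permMatrix ℂ)ᵀ * antiDiag n * π.permMatrix ℂ = 1 := by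
  rw [antiDiag_eq_permMatrix, transpose_permMatrix, ← permMatrix_mul, ← permMatrix_mul,
    ← permMatrix_mul]
  have : π * (Fin.revPerm * (π⁻¹ * Fin.revPerm)) = 1 := by
    ext i
    simp [h]
  rw [this, permMatrix_one]

/-- The sign of the permutation is $(-1)^{2\ell+\mu}$, so the determinant is $1$ because $\mu$ is
even. -/
theorem nMat_mem_SO {ℓ : ℕ} (p : Nat.Partition ℓ) (hp : Even p.parts.card) : nMat p ∈ SO ℓ := by
  obtain ⟨π, h1, h2, h3⟩ := exists_perm_nMat p
  rw [mem_SO_iff, h1]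
  refine ⟨antiDiag_mul_transpose_permMatrix h3, ?_⟩
  rw [det_permutation, Equiv.Perm.sign_of_cycleType, h2, Multiset.sum_map_mul_left,
    Multiset.card_map, Even.neg_one_pow]
  · simp
  · exact (even_two_mul _).add hp

/-- Nonemptiness matters: the lcm of the empty multiset is $1$. -/
theorem lcm_map_two_mul {s : Multiset ℕ} (hs : s ≠ 0) : (s.map (2 * ·)).lcm = 2 * s.lcm := by
  apply Nat.dvd_antisymm
  · refine Multiset.lcm_dvd.2 fun b hb => ?_
    obtain ⟨a, ha, rfl⟩ := Multiset.mem_map.1 hb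
    exact mul_dvd_mul_left 2 (Multiset.dvd_lcm ha)
  · have h := fun a (ha : a ∈ s) => Multiset.dvd_lcm (Multiset.mem_map_of_mem (2 * ·) ha)
    obtain ⟨a, ha⟩ := Multiset.exists_mem_of_ne_zero hs
    obtain ⟨L, hL⟩ : 2 ∣ (s.map (2 * ·)).lcm := dvd_trans (dvd_mul_right 2 a) (h a ha)
    rw [hL] at h ⊢
    exact mul_dvd_mul_left 2
      (Multiset.lcm_dvd.2 fun b hb => Nat.dvd_of_mul_dvd_mul_left two_pos (h b hb))

theorem parts_ne_zero {ℓ : ℕ} (hl : 0 < ℓ) (p : Nat.Partition ℓ) : p.parts ≠ 0 := by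
  intro h
  have := p.parts_sum
  rw [h, Multiset.sum_zero] at this
  omega

theorem orderOf_nMat {ℓ : ℕ} (hl : 0 < ℓ) (p : Nat.Partition ℓ) : orderOf (nMat p) = mOf p := by
  obtain ⟨π, h1, h2, -⟩ := exists_perm_nMat p
  rw [h1, orderOf_permMatrix, ← Equiv.Perm.lcm_cycleType, h2, lcm_map_two_mul (parts_ne_zero hl p),
    mOf]

theorem mOf_pos {ℓ : ℕ} (p : Nat.Partition ℓ) : 0 < mOf p := by
  refine Nat.mul_pos two_pos (Nat.pos_of_ne_zero ?_)
  rw [Ne, Multiset.lcm_eq_zero_iff]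
  exact fun h => (p.parts_pos h).ne' rfl

open Polynomial in
theorem charpoly_nMat {ℓ : ℕ} (p : Nat.Partition ℓ) :
    (nMat p).charpoly = (p.parts.map fun q => (X ^ (2 * q) - 1 : ℂ[X])).prod := by
  obtain ⟨π, h1, h2, -⟩ := exists_perm_nMat p
  -- The cycle lengths add up to $2\ell$, so there are no fixed points and no extra factors $X-1$.
  have h3 : π.support.card = 2 * ℓ := by
    rw [← Equiv.Perm.sum_cycleType, h2, Multiset.sum_map_mul_left, Multiset.map_id', p.parts_sum]
  rw [h1, charpoly_permMatrix, h2, h3, Fintype.card_fin, Nat.sub_self, pow_zero, mul_one,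
    Multiset.map_map]
  rfl

/-! ### Factorization of the characteristic polynomial -/

open Polynomial in
theorem X_pow_sub_one_eq_prod_range {N : ℕ} {ζ : ℂ} (hζ : IsPrimitiveRoot ζ N) (hN : 0 < N) :
    (X ^ N - 1 : ℂ[X]) = ∏ k ∈ Finset.range N, (X - C (ζ ^ k)) := by
  have h1 : (X ^ N - 1 : ℂ[X]) = ((nthRoots N (1 : ℂ)).map fun a => X - C a).prod := by
    have h := (IsAlgClosed.splits (X ^ N - C (1 : ℂ))).eq_prod_roots_of_monic
      (monic_X_pow_sub_C _ hN.ne')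
    rwa [C_1] at h
  rw [h1, hζ.nthRoots_eq (one_pow N), Multiset.map_map, Finset.prod]
  simp

-- The exponents $a$ and $2q-a$ give inverse roots. Only $0$ and $q$ are paired with themselves, and
-- they give the roots $1$ and $-1$.
open Polynomial in
theorem X_pow_two_mul_sub_one {q : ℕ} (hq : 0 < q) {ζ : ℂ} (hζ : IsPrimitiveRoot ζ (2 * q)) :
    (X ^ (2 * q) - 1 : ℂ[X]) = (X - 1) * (X + 1) *
      ∏ a ∈ Finset.Icc 1 (q - 1), ((X - C (ζ ^ a)) * (X - C (ζ ^ a)⁻¹)) := by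
  obtain ⟨b, rfl⟩ : ∃ b, q = b + 1 := ⟨q - 1, by omega⟩
  have h0 : ζ ≠ 0 := hζ.ne_zero (by omega)
  have hneg : ζ ^ (b + 1) = -1 := by
    have h := hζ.pow (by omega) (show 2 * (b + 1) = (b + 1) * 2 by ring)
    exact h.eq_neg_one_of_two_right
  rw [X_pow_sub_one_eq_prod_range hζ (by omega), two_mul, Finset.prod_range_add,
    Finset.prod_range_succ', Finset.prod_range_succ' _ b,
    ← Finset.prod_range_reflect (fun k => (X - C (ζ ^ (b + 1 + (k + 1))))) b,
    Finset.prod_mul_distrib, Nat.add_sub_cancel]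
  have hI : ∀ F : ℕ → ℂ[X], ∏ a ∈ Finset.Icc 1 b, F a = ∏ k ∈ Finset.range b, F (k + 1) := by
    intro F
    rw [← Finset.Ico_add_one_right_eq_Icc, Finset.prod_Ico_eq_prod_range]
    simp [add_comm]
  rw [hI, hI]
  have h2 : ∏ j ∈ Finset.range b, (X - C (ζ ^ (b + 1 + (b - 1 - j + 1)))) =
      ∏ k ∈ Finset.range b, (X - C (ζ ^ (k + 1))⁻¹ : ℂ[X]) := by
    refine Finset.prod_congr rfl fun j hj => ?_
    have hj := Finset.mem_range.1 hj
    congr 2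
    refine eq_inv_of_mul_eq_one_left ?_
    rw [← pow_add, ← hζ.pow_eq_one]
    congr 1
    omega
  rw [h2, add_zero, hneg, pow_zero, C_neg, C_1]
  ring

theorem prod_fin_two_mul {M : Type*} [CommMonoid M] {ℓ : ℕ} (F G : Fin ℓ → M) :
    (∏ i : Fin (2 * ℓ), if h : (i : ℕ) < ℓ then F ⟨i, h⟩ else G ⟨2 * ℓ - 1 - i, by omega⟩) =
      ∏ i, F i * G i := by
  rw [← Fin.prod_congr' _ (two_mul ℓ).symm, Fin.prod_univ_add, Finset.prod_mul_distrib]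
  congr 1
  · refine Finset.prod_congr rfl fun i _ => ?_
    rw [dif_pos (by simp)]
    rfl
  · rw [← Equiv.prod_comp Fin.revPerm]
    refine Finset.prod_congr rfl fun i _ => ?_
    rw [dif_neg (by simp)]
    congr 1
    have := i.isLt
    simp only [Fin.ext_iff, Fin.val_cast, Fin.val_natAdd, Fin.revPerm_apply, Fin.val_rev]
    omega

open Polynomial in
theorem charpoly_cochar {ℓ : ℕ} (lam : Fin ℓ → ℤ) (z : ℂ) :
    (cochar lam z).charpoly = ∏ i, ((X - C (z ^ lam i)) * (X - C (z ^ lam i)⁻¹)) := by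
  rw [cochar, charpoly_diagonal, ← prod_fin_two_mul]
  refine Finset.prod_congr rfl fun i _ => ?_
  split_ifs
  · rfl
  · rw [_root_.zpow_neg]

theorem map_univ_getD {L : List ℕ} {n : ℕ} (h : L.length = n) :
    (Finset.univ : Finset (Fin n)).val.map (fun i : Fin n => L.getD i 0) = L := by
  subst h
  rw [Fin.univ_val_map]
  congr 1
  have h : (fun i : Fin L.length => L.getD i 0) = fun i : Fin L.length => L[(i : ℕ)] :=
    funext fun i => List.getD_eq_getElem _ _ i.isLt
  rw [h, List.ofFn_getElem]

/-- The cocharacter with coordinates `σ_1, …, σ_ℓ`. -/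
def sigmaVec {ℓ : ℕ} (p : Nat.Partition ℓ) : Fin ℓ → ℤ := fun i => σ p (i + 1)

theorem map_sigmaVec {ℓ : ℕ} (p : Nat.Partition ℓ) (hp : Even p.parts.card) :
    Finset.univ.val.map (sigmaVec p) = (entries p).map fun n : ℕ => (n : ℤ) := by
  have h := map_univ_getD (L := (entries p).sort (· ≥ ·)) (n := ℓ)
    (by rw [Multiset.length_sort, card_entries p hp])
  rw [Multiset.sort_eq] at h
  rw [← h, Multiset.map_map]
  rfl

theorem two_mul_dvd_mOf {ℓ : ℕ} (p : Nat.Partition ℓ) {q : ℕ} (hq : q ∈ p.parts) :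
    2 * q ∣ mOf p := mul_dvd_mul_left 2 (Multiset.dvd_lcm hq)

open Polynomial in
theorem charpoly_nMat_eq_cochar {ℓ : ℕ} (p : Nat.Partition ℓ) (hp : Even p.parts.card) {ξ : ℂ}
    (hξ : IsPrimitiveRoot ξ (mOf p)) : (nMat p).charpoly = (cochar (sigmaVec p) ξ).charpoly := by
  have hm := mOf_pos p
  let F : ℕ → ℂ[X] := fun e => (X - C (ξ ^ e)) * (X - C (ξ ^ e)⁻¹)
  have h1 : (cochar (sigmaVec p) ξ).charpoly = ((entries p).map F).prod := by
    rw [charpoly_cochar, Finset.prod]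
    have := congrArg (fun s => (s.map fun e : ℤ => (X - C (ξ ^ e)) * (X - C (ξ ^ e)⁻¹)).prod)
      (map_sigmaVec p hp)
    simpa only [Multiset.map_map, Function.comp_def, zpow_natCast] using this
  obtain ⟨c, hc⟩ := hp
  have hhalf : ξ ^ (mOf p / 2) = -1 := by
    refine (hξ.pow hm (a := mOf p / 2) (b := 2) ?_).eq_neg_one_of_two_right
    rw [mOf]; omega
  have hF0 : F 0 = (X - 1) ^ 2 := by
    simp only [F, pow_zero, inv_one, C_1]; ring
  have hFh : F (mOf p / 2) = (X + 1) ^ 2 := by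
    simp only [F, hhalf, inv_neg, inv_one, C_neg, C_1]; ring
  rw [h1, charpoly_nMat, entries, Multiset.map_add, Multiset.map_add, Multiset.prod_add,
    Multiset.prod_add, Multiset.map_replicate, Multiset.map_replicate, Multiset.prod_replicate,
    Multiset.prod_replicate, Multiset.map_bind, Multiset.prod_bind, hF0, hFh]
  have h2 : p.parts.map (fun q => (X ^ (2 * q) - 1 : ℂ[X])) =
      p.parts.map fun q => ((X - 1) * (X + 1)) * ((Finset.Icc 1 (q - 1)).val.map
        fun a => F (a * mOf p / (2 * q))).prod := by
    refine Multiset.map_congr rfl fun q hq => ?_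
    have hq0 := p.parts_pos hq
    -- Since $m=2qt$, the power $\xi^t$ is a primitive $2q$-th root of unity and $am/(2q)=ta$.
    obtain ⟨t, ht⟩ := two_mul_dvd_mOf p hq
    rw [X_pow_two_mul_sub_one hq0 (hξ.pow hm (ht.trans (mul_comm _ _)))]
    congr 1
    rw [Finset.prod]
    congr 1
    refine Multiset.map_congr rfl fun a _ => ?_
    have : a * mOf p / (2 * q) = t * a := by
      rw [ht, mul_left_comm, Nat.mul_div_cancel_left _ (by omega), mul_comm]
    simp only [F, this, pow_mul]
  rw [h2, Multiset.prod_map_mul, Multiset.map_const', Multiset.prod_replicate, hc,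
    show (c + c) / 2 = c by omega]
  simp only [Multiset.map_map, Function.comp_def]
  rw [mul_pow, ← pow_mul, ← pow_mul, ← two_mul]
  ring

/-! ### Uniqueness of the cocharacter -/

theorem sigmaVec_antitone {ℓ : ℕ} (p : Nat.Partition ℓ) : Antitone (sigmaVec p) := by
  intro i j hij
  rcases hij.eq_or_lt with rfl | hij
  · exact le_rfl
  simp only [sigmaVec, σ, Nat.add_sub_cancel, Nat.cast_le]
  set L := (entries p).sort (· ≥ ·) with hL
  by_cases hj : (j : ℕ) < L.length
  · rw [List.getD_eq_getElem _ _ hj, List.getD_eq_getElem _ _ (lt_trans hij hj)]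
    have h := Multiset.pairwise_sort (entries p) (· ≥ ·)
    exact List.pairwise_iff_getElem.1 h i j _ _ hij
  · rw [List.getD_eq_default _ _ (not_lt.1 hj)]
    exact Nat.zero_le _

theorem two_mul_le_of_mem_entries {ℓ : ℕ} {p : Nat.Partition ℓ} {n : ℕ} (hn : n ∈ entries p) :
    2 * n ≤ mOf p := by
  rw [entries, Multiset.mem_add, Multiset.mem_add, Multiset.mem_bind] at hn
  rcases hn with (⟨q, hq, hn⟩ | hn) | hn
  · obtain ⟨a, ha, rfl⟩ := Multiset.mem_map.1 hn
    have ha : a ∈ Finset.Icc 1 (q - 1) := ha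
    rw [Finset.mem_Icc] at ha
    obtain ⟨t, ht⟩ := two_mul_dvd_mOf p hq
    have hq0 := p.parts_pos hq
    rw [ht, mul_left_comm, Nat.mul_div_cancel_left _ (by omega), mul_assoc]
    exact Nat.mul_le_mul_left 2 (Nat.mul_le_mul_right t (by omega))
  · rw [Multiset.eq_of_mem_replicate hn]
    omega
  · rw [Multiset.eq_of_mem_replicate hn]
    omega

theorem sigmaVec_bounds {ℓ : ℕ} (p : Nat.Partition ℓ) (hp : Even p.parts.card) (i : Fin ℓ) :
    0 ≤ sigmaVec p i ∧ 2 * sigmaVec p i ≤ mOf p := by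
  have h : sigmaVec p i ∈ Finset.univ.val.map (sigmaVec p) :=
    Multiset.mem_map_of_mem _ (Finset.mem_univ i)
  rw [map_sigmaVec p hp] at h
  obtain ⟨n, hn, h⟩ := Multiset.mem_map.1 h
  have := two_mul_le_of_mem_entries hn
  omega

theorem exists_sigmaVec_eq {ℓ : ℕ} (p : Nat.Partition ℓ) (hp : Even p.parts.card) {n : ℕ}
    (hn : n ∈ entries p) : ∃ i, sigmaVec p i = n := by
  have h : (n : ℤ) ∈ Finset.univ.val.map (sigmaVec p) := by
    rw [map_sigmaVec p hp]
    exact Multiset.mem_map_of_mem _ hn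
  obtain ⟨i, -, hi⟩ := Multiset.mem_map.1 h
  exact ⟨i, hi⟩

theorem card_parts_half_ne_zero {ℓ : ℕ} (hl : 0 < ℓ) (p : Nat.Partition ℓ)
    (hp : Even p.parts.card) : p.parts.card / 2 ≠ 0 := by
  have := Multiset.card_pos.2 (parts_ne_zero hl p)
  obtain ⟨c, hc⟩ := hp
  omega

theorem exists_two_mul_sigmaVec_eq {ℓ : ℕ} (hl : 0 < ℓ) (p : Nat.Partition ℓ)
    (hp : Even p.parts.card) : ∃ i, 2 * sigmaVec p i = mOf p := by
  obtain ⟨i, hi⟩ := exists_sigmaVec_eq p hp (n := mOf p / 2) (by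
    rw [entries, Multiset.mem_add, Multiset.mem_add]
    exact Or.inl (Or.inr (Multiset.mem_replicate.2 ⟨card_parts_half_ne_zero hl p hp, rfl⟩)))
  refine ⟨i, ?_⟩
  rw [hi, mOf]
  omega

theorem exists_sigmaVec_eq_zero {ℓ : ℕ} (hl : 0 < ℓ) (p : Nat.Partition ℓ)
    (hp : Even p.parts.card) : ∃ i, sigmaVec p i = 0 := by
  refine exists_sigmaVec_eq p hp (n := 0) ?_
  rw [entries, Multiset.mem_add]
  exact Or.inr (Multiset.mem_replicate.2 ⟨card_parts_half_ne_zero hl p hp, rfl⟩)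

-- The function $z+z^{-1}$ separates eigenvalues exactly up to inversion, so it turns the spectrum
-- into the wanted multiset with all multiplicities doubled.
open Polynomial in
theorem exists_perm_of_charpoly_cochar_eq {ℓ m : ℕ} {lam μ : Fin ℓ → ℤ} {ξ : ℂ}
    (hξ : IsPrimitiveRoot ξ m) (hm : 0 < m)
    (h : (cochar lam ξ).charpoly = (cochar μ ξ).charpoly) :
    ∃ τ : Equiv.Perm (Fin ℓ), ∀ i, (m : ℤ) ∣ lam i - μ (τ i) ∨ (m : ℤ) ∣ lam i + μ (τ i) := by
  have h0 : ξ ≠ 0 := hξ.ne_zero hm.ne'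
  have hroots : ∀ lam : Fin ℓ → ℤ, (cochar lam ξ).charpoly.roots =
      Finset.univ.val.map (fun i => ξ ^ lam i) +
        Finset.univ.val.map (fun i => (ξ ^ lam i)⁻¹) := by
    intro lam
    have h1 : (cochar lam ξ).charpoly = ((Finset.univ.val.map (fun i => ξ ^ lam i) +
        Finset.univ.val.map (fun i => (ξ ^ lam i)⁻¹)).map fun a => X - C a).prod := by
      rw [charpoly_cochar, Finset.prod_mul_distrib, Multiset.map_add, Multiset.prod_add,
        Multiset.map_map, Multiset.map_map]
      rfl
    rw [h1, roots_multiset_prod_X_sub_C]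
  have h1 := congrArg (fun f => f.roots.map fun z => z + z⁻¹) h
  simp only [hroots, Multiset.map_add, Multiset.map_map, Function.comp_def, inv_inv] at h1
  have hadd : ∀ lam : Fin ℓ → ℤ, Finset.univ.val.map (fun i => (ξ ^ lam i)⁻¹ + ξ ^ lam i) =
      Finset.univ.val.map fun i => ξ ^ lam i + (ξ ^ lam i)⁻¹ := by
    intro lam
    simp only [add_comm]
  rw [hadd, hadd, ← two_nsmul, ← two_nsmul] at h1
  have h2 : Finset.univ.val.map (fun i => ξ ^ lam i + (ξ ^ lam i)⁻¹) =
      Finset.univ.val.map fun i => ξ ^ μ i + (ξ ^ μ i)⁻¹ := by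
    ext a
    have := congrArg (Multiset.count a) h1
    rw [Multiset.count_nsmul, Multiset.count_nsmul] at this
    omega
  obtain ⟨τ, hτ⟩ := exists_perm_of_map_univ_eq h2
  refine ⟨τ, fun i => ?_⟩
  have h3 := hτ i
  have hu : ξ ^ lam i ≠ 0 := zpow_ne_zero _ h0
  have hv : ξ ^ μ (τ i) ≠ 0 := zpow_ne_zero _ h0
  have h4 : (ξ ^ lam i - ξ ^ μ (τ i)) * (ξ ^ lam i * ξ ^ μ (τ i) - 1) = 0 := by
    field_simp at h3
    linear_combination h3
  rcases mul_eq_zero.1 h4 with h5 | h5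
  · left
    rw [← hξ.zpow_eq_one_iff_dvd, zpow_sub₀ h0, sub_eq_zero.1 h5, div_self hv]
  · right
    rw [← hξ.zpow_eq_one_iff_dvd, zpow_add₀ h0, sub_eq_zero.1 h5]

/-- A decreasing rearrangement is unique; negation passes to monotone tuples. -/
theorem eq_of_antitone_of_comp_perm {n : ℕ} {f g : Fin n → ℤ} (hf : Antitone f) (hg : Antitone g)
    (τ : Equiv.Perm (Fin n)) (h : ∀ i, f i = g (τ i)) : f = g := by
  have h1 : (-g) ∘ τ = -f := by
    funext i
    simp [h]
  have h2 := (Tuple.comp_sort_eq_comp_iff_monotone (f := -g) (σ := τ)).2 (h1 ▸ hf.neg)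
  have h3 := (Tuple.comp_sort_eq_comp_iff_monotone (f := -g) (σ := 1)).2 hg.neg
  rw [h1] at h2
  exact neg_injective (h2.trans h3.symm)

theorem eq_of_int_dvd_of_abs_lt {m a : ℤ} (h : m ∣ a) (h1 : -m < a) (h2 : a < m) : a = 0 :=
  Int.eq_zero_of_abs_lt_dvd h (abs_lt.2 ⟨h1, h2⟩)

theorem eq_sigmaVec {ℓ : ℕ} (hl : 4 ≤ ℓ) (p : Nat.Partition ℓ) (hp : Even p.parts.card) {ξ : ℂ}
    (hξ : IsPrimitiveRoot ξ (mOf p)) {lam : Fin ℓ → ℤ}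
    (h : (cochar lam ξ).charpoly = (cochar (sigmaVec p) ξ).charpoly)
    (hsub : ∀ i j, i < j → lam j ≤ lam i) (hadd : ∀ i j, i < j → 0 ≤ lam i + lam j)
    (hle : ∀ i j, i < j → lam i + lam j ≤ mOf p) : lam = sigmaVec p := by
  have hm := mOf_pos p
  obtain ⟨τ, hτ⟩ := exists_perm_of_charpoly_cochar_eq hξ hm h
  have hb := sigmaVec_bounds p hp
  have hanti : Antitone lam := fun i j hij => hij.eq_or_lt.elim (fun h => h ▸ le_rfl) (hsub i j)
  have hhalf := exists_two_mul_sigmaVec_eq (by omega) p hp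
  generalize mOf p = m at *
  let z : Fin ℓ := ⟨0, by omega⟩
  let o : Fin ℓ := ⟨1, by omega⟩
  let w : Fin ℓ := ⟨ℓ - 1, by omega⟩
  have hzo : z < o := by simp [z, o]
  have how : o < w := by simp only [o, w, Fin.lt_def]; omega
  have hzw : z < w := hzo.trans how
  have hlez : ∀ i, lam i ≤ lam z := fun i => hanti (by simp [z, Fin.le_def])
  have hlew : ∀ i, lam w ≤ lam i := fun i => hanti (by
    have := i.isLt
    simp only [w, Fin.le_def]; omega)
  have h1 := hle z o hzo
  have h2 := hadd z o hzo
  have h3 := hadd o w how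
  have h4 := hlez o
  have h5 := hlew o
  -- Some $\lambda_j$ is congruent to $m/2$ modulo $m$, whichever the sign.
  have hz : 2 * lam z ≤ m := by
    obtain ⟨i, hi⟩ := hhalf
    obtain ⟨j, rfl⟩ := τ.surjective i
    have h6 := hlez j
    have h7 := hlew j
    have h8 : (m : ℤ) ∣ lam j - sigmaVec p (τ j) := by
      rcases hτ j with h | h
      · exact h
      · have h' : lam j - sigmaVec p (τ j) = lam j + sigmaVec p (τ j) - m := by omega
        rw [h']
        exact dvd_sub_self_right.2 h
    -- If $\lambda_j=-m/2$, then $\lambda_\ell\le -m/2$ forces $\lambda_2\ge m/2$. Otherwise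
    -- $\lambda_j=m/2$, and for $j\ne1$ again $\lambda_2\ge m/2$. In both of these cases
    -- $\lambda_1+\lambda_2\le m$ gives the bound.
    by_cases h9 : lam j - sigmaVec p (τ j) = -m
    · omega
    · have h10 := eq_of_int_dvd_of_abs_lt h8 (by omega) (by omega)
      by_cases hj : j = z
      · have := congrArg lam hj
        omega
      · have h11 : lam j ≤ lam o := hanti (by
          simp only [z, Fin.ext_iff] at hj
          simp only [o, Fin.le_def]
          omega)
        omega
  -- Some $\lambda_j$ is divisible by $m$, and $|\lambda_j|\le m/2$, so it vanishes. For $j\ne\ell$,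
  -- $0\le\lambda_j+\lambda_\ell$ and $\lambda_\ell\le\lambda_j$ give $\lambda_\ell=0$.
  have hw : lam w = 0 := by
    obtain ⟨i, hi⟩ := exists_sigmaVec_eq_zero (by omega) p hp
    obtain ⟨j, rfl⟩ := τ.surjective i
    have h6 := hlez j
    have h7 := hlew j
    have h8 : (m : ℤ) ∣ lam j := by
      have := hτ j
      rwa [hi, sub_zero, add_zero, or_self] at this
    have h9 := eq_of_int_dvd_of_abs_lt h8 (by omega) (by omega)
    by_cases hj : j = w
    · rw [← hj, h9]
    · have := hadd j w (by
        have := j.isLt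
        simp only [w, Fin.ext_iff] at hj
        simp only [w, Fin.lt_def]
        omega)
      omega
  refine eq_of_antitone_of_comp_perm hanti (sigmaVec_antitone p) τ fun i => ?_
  have h6 := hlez i
  have h7 := hlew i
  have h8 := hb (τ i)
  rcases hτ i with h | h
  · have := eq_of_int_dvd_of_abs_lt h (by omega) (by omega)
    omega
  -- Both terms lie in $[0,m/2]$: a sum $m$ means that both are $m/2$, a sum $0$ that both vanish.
  · by_cases h9 : lam i + sigmaVec p (τ i) = m
    · omega
    · have := eq_of_int_dvd_of_abs_lt h (by omega) (by omega)
      omega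

/-! ### The alcove and the labels -/

theorem e_dotProduct {ℓ : ℕ} (i : Fin ℓ) (v : Fin ℓ → ℝ) : e i ⬝ᵥ v = v i := by
  rw [e, single_dotProduct, one_mul]

theorem mem_alcove_iff {ℓ : ℕ} (v : Fin ℓ → ℝ) : v ∈ alcove ℓ ↔
    ∀ i j, i < j → (0 < v i - v j ∧ v i - v j < 1) ∧ 0 < v i + v j ∧ v i + v j < 1 := by
  constructor
  · intro h i j hij
    have h1 := h _ ⟨i, j, hij, Or.inl rfl⟩
    have h2 := h _ ⟨i, j, hij, Or.inr rfl⟩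
    rw [sub_dotProduct, e_dotProduct, e_dotProduct] at h1
    rw [add_dotProduct, e_dotProduct, e_dotProduct] at h2
    exact ⟨h1, h2⟩
  · rintro h _ ⟨i, j, hij, rfl | rfl⟩
    · rw [sub_dotProduct, e_dotProduct, e_dotProduct]
      exact (h i j hij).1
    · rw [add_dotProduct, e_dotProduct, e_dotProduct]
      exact (h i j hij).2

theorem mem_closure_alcove_iff {ℓ : ℕ} (v : Fin ℓ → ℝ) : v ∈ closure (alcove ℓ) ↔
    ∀ i j, i < j → (0 ≤ v i - v j ∧ v i - v j ≤ 1) ∧ 0 ≤ v i + v j ∧ v i + v j ≤ 1 := by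
  constructor
  · have hcl : IsClosed {v : Fin ℓ → ℝ | ∀ i j, i < j →
        (0 ≤ v i - v j ∧ v i - v j ≤ 1) ∧ 0 ≤ v i + v j ∧ v i + v j ≤ 1} := by
      simp only [Set.ofPred_forall, Set.ofPred_and]
      refine isClosed_iInter fun i => isClosed_iInter fun j => isClosed_iInter fun _ => ?_
      refine ((isClosed_le ?_ ?_).inter (isClosed_le ?_ ?_)).inter
        ((isClosed_le ?_ ?_).inter (isClosed_le ?_ ?_)) <;> fun_prop
    refine fun h => closure_minimal (fun v hv => ?_) hcl h
    intro i j hij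
    have := (mem_alcove_iff v).1 hv i j hij
    exact ⟨⟨this.1.1.le, this.1.2.le⟩, this.2.1.le, this.2.2.le⟩
  · intro h
    -- An interior point of the alcove, with equally spaced coordinates from $1/2$ down to
    -- $1/(2\ell)$. The segment from `v` to `c` lies in the alcove apart from its endpoint `v`.
    let c : Fin ℓ → ℝ := fun i => (ℓ - i) / (2 * ℓ)
    let f : ℝ → Fin ℓ → ℝ := fun t i => (1 - t) * v i + t * c i
    have hf : Continuous f := by fun_prop
    have hc : ∀ i j : Fin ℓ, i < j →
        (0 < c i - c j ∧ c i - c j < 1) ∧ 0 < c i + c j ∧ c i + c j < 1 := by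
      intro i j hij
      have h1 : ((i : ℕ) : ℝ) + 1 ≤ (j : ℕ) := by exact_mod_cast hij
      have h2 : ((j : ℕ) : ℝ) + 1 ≤ ℓ := by exact_mod_cast j.isLt
      have h3 : (0 : ℝ) ≤ (i : ℕ) := Nat.cast_nonneg _
      have h4 : (0 : ℝ) < 2 * ℓ := by linarith
      have e1 : c i - c j = ((j : ℕ) - (i : ℕ)) / (2 * ℓ) := by simp only [c]; ring
      have e2 : c i + c j = (2 * ℓ - (i : ℕ) - (j : ℕ)) / (2 * ℓ) := by simp only [c]; ring
      rw [e1, e2, div_lt_one h4, div_lt_one h4]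
      refine ⟨⟨div_pos ?_ h4, ?_⟩, div_pos ?_ h4, ?_⟩ <;> linarith
    have hmaps : Set.MapsTo f (Set.Ioo 0 1) (alcove ℓ) := by
      rintro t ⟨ht0, ht1⟩
      rw [mem_alcove_iff]
      intro i j hij
      obtain ⟨⟨a1, a2⟩, a3, a4⟩ := h i j hij
      obtain ⟨⟨b1, b2⟩, b3, b4⟩ := hc i j hij
      have e1 : f t i - f t j = (1 - t) * (v i - v j) + t * (c i - c j) := by simp only [f]; ring
      have e2 : f t i + f t j = (1 - t) * (v i + v j) + t * (c i + c j) := by simp only [f]; ring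
      have ht : 0 ≤ 1 - t := by linarith
      rw [e1, e2]
      refine ⟨⟨?_, ?_⟩, ?_, ?_⟩
      · exact add_pos_of_nonneg_of_pos (mul_nonneg ht a1) (mul_pos ht0 b1)
      · linarith [mul_le_mul_of_nonneg_left a2 ht, mul_lt_mul_of_pos_left b2 ht0]
      · exact add_pos_of_nonneg_of_pos (mul_nonneg ht a3) (mul_pos ht0 b3)
      · linarith [mul_le_mul_of_nonneg_left a4 ht, mul_lt_mul_of_pos_left b4 ht0]
    have h0 : (0 : ℝ) ∈ closure (Set.Ioo 0 1) := by
      rw [closure_Ioo zero_ne_one]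
      exact ⟨le_rfl, zero_le_one⟩
    have := map_mem_closure hf h0 hmaps
    have hf0 : f 0 = v := by
      funext i
      simp [f]
    rwa [hf0] at this

theorem simpleRoot_dotProduct {ℓ : ℕ} (k : Fin ℓ) (v : Fin ℓ → ℝ) : simpleRoot k ⬝ᵥ v =
    if h : (k : ℕ) + 1 < ℓ then v k - v ⟨k + 1, h⟩ else v ⟨k - 1, by omega⟩ + v k := by
  unfold simpleRoot
  split_ifs
  · rw [sub_dotProduct, e_dotProduct, e_dotProduct]
  · rw [add_dotProduct, e_dotProduct, e_dotProduct]

/-- The roots $e_{\ell-1}\pm e_\ell$ determine the last coordinate; the differences $e_k-e_{k+1}$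
then determine the others, going backwards. -/
theorem eq_of_simpleRoot_dotProduct_eq {ℓ : ℕ} (hl : 2 ≤ ℓ) {v w : Fin ℓ → ℝ}
    (h : ∀ k, simpleRoot k ⬝ᵥ v = simpleRoot k ⬝ᵥ w) : v = w := by
  simp only [simpleRoot_dotProduct] at h
  have key : ∀ n (hn : n < ℓ), v ⟨ℓ - 1 - n, by omega⟩ = w ⟨ℓ - 1 - n, by omega⟩ := by
    intro n hn
    induction n with
    | zero =>
      have h1 := h ⟨ℓ - 1, by omega⟩
      have h2 := h ⟨ℓ - 1 - 1, by omega⟩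
      rw [dif_neg (by dsimp only; omega), dif_neg (by dsimp only; omega)] at h1
      rw [dif_pos (by dsimp only; omega), dif_pos (by dsimp only; omega)] at h2
      have e1 : (⟨ℓ - 1 - 1 + 1, by omega⟩ : Fin ℓ) = ⟨ℓ - 1, by omega⟩ := by
        rw [Fin.mk.injEq]; omega
      simp only [e1, Nat.sub_zero] at h1 h2 ⊢
      linarith
    | succ n ih =>
      have h1 := ih (by omega)
      have h2 := h ⟨ℓ - 1 - (n + 1), by omega⟩
      rw [dif_pos (by dsimp only; omega), dif_pos (by dsimp only; omega)] at h2
      have e1 : (⟨ℓ - 1 - (n + 1) + 1, by omega⟩ : Fin ℓ) = ⟨ℓ - 1 - n, by omega⟩ := by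
        rw [Fin.mk.injEq]; omega
      simp only [e1] at h2
      linarith
  funext i
  have := key (ℓ - 1 - i) (by omega)
  have e1 : (⟨ℓ - 1 - (ℓ - 1 - i), by omega⟩ : Fin ℓ) = i := by
    rw [Fin.ext_iff]; dsimp only; omega
  rwa [e1] at this

theorem simpleRoot_dotProduct_sum {ℓ : ℕ} (hl : 4 ≤ ℓ) (a : Fin ℓ → ℝ) (j : Fin ℓ) :
    simpleRoot j ⬝ᵥ ∑ k, a k • coweight k = a j := by
  rw [dotProduct_sum]
  simp [dotProduct_smul, simpleRoot_dotProduct_coweight hl]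

theorem sum_smul_coweight_eq_iff {ℓ : ℕ} (hl : 4 ≤ ℓ) (a v : Fin ℓ → ℝ) :
    ∑ k, a k • coweight k = v ↔ ∀ k, a k = simpleRoot k ⬝ᵥ v := by
  constructor
  · rintro rfl k
    rw [simpleRoot_dotProduct_sum hl]
  · intro h
    refine eq_of_simpleRoot_dotProduct_eq (by omega) fun k => ?_
    rw [simpleRoot_dotProduct_sum hl, h]

theorem sigmaLabels_succ {ℓ : ℕ} (hl : 2 ≤ ℓ) (p : Nat.Partition ℓ) (k : Fin ℓ) :
    (sigmaLabels p k.succ : ℝ) = simpleRoot k ⬝ᵥ fun i => (sigmaVec p i : ℝ) := by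
  have := k.isLt
  rw [simpleRoot_dotProduct, sigmaLabels, Fin.val_succ, if_neg (by omega)]
  split_ifs
  · rw [Int.cast_sub]
    rfl
  · have hk : (k : ℕ) = ℓ - 1 := by omega
    rw [Int.cast_add]
    simp only [sigmaVec, hk]
    rw [show ℓ - 1 - 1 + 1 = ℓ - 1 by omega, show ℓ - 1 + 1 = ℓ by omega]

/-- Pair with the highest root $e_1+e_2$, whose coefficients are the marks: the nodes other than
$\gamma_0$ contribute $v_1+v_2$, and $\gamma_0$ has mark $1$. -/
theorem sum_mark_eq_iff {ℓ : ℕ} (hl : 4 ≤ ℓ) {s : Fin (ℓ + 1) → ℤ} {v : Fin ℓ → ℤ} {m : ℤ}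
    (h : ∑ k : Fin ℓ, (s k.succ : ℝ) • coweight k = fun i => (v i : ℝ)) :
    m = ∑ k, s k * (mark k : ℤ) ↔ s 0 = m - (v ⟨0, by omega⟩ + v ⟨1, by omega⟩) := by
  have h1 : ((∑ k : Fin ℓ, s k.succ * (mark k.succ : ℤ) : ℤ) : ℝ) =
      ((v ⟨0, by omega⟩ + v ⟨1, by omega⟩ : ℤ) : ℝ) := by
    have h2 := congrArg (fun w => (e ⟨0, by omega⟩ + e ⟨1, by omega⟩ : Fin ℓ → ℝ) ⬝ᵥ w) h
    simp only [dotProduct_sum, dotProduct_smul, highestRoot_dotProduct_coweight hl,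
      smul_eq_mul] at h2
    rw [add_dotProduct, e_dotProduct, e_dotProduct] at h2
    push_cast
    exact h2
  rw [Fin.sum_univ_succ, Int.cast_injective h1]
  have h0 : mark (0 : Fin (ℓ + 1)) = 1 := by simp [mark]
  rw [h0]
  push_cast
  constructor <;> intro h <;> linarith

theorem eq_sigmaLabels_iff {ℓ : ℕ} (hl : 4 ≤ ℓ) (p : Nat.Partition ℓ) (s : Fin (ℓ + 1) → ℤ) :
    ((fun i => (sigmaVec p i : ℝ) / (mOf p : ℝ)) =
        (1 / (mOf p : ℝ)) • ∑ k : Fin ℓ, (s k.succ : ℝ) • coweight k ∧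
      (mOf p : ℤ) = ∑ k, s k * (mark k : ℤ)) ↔ s = sigmaLabels p := by
  have hm : (mOf p : ℝ) ≠ 0 := Nat.cast_ne_zero.2 (mOf_pos p).ne'
  have h1 : (fun i => (sigmaVec p i : ℝ) / (mOf p : ℝ)) =
      (1 / (mOf p : ℝ)) • ∑ k : Fin ℓ, (s k.succ : ℝ) • coweight k ↔
      ∑ k : Fin ℓ, (s k.succ : ℝ) • coweight k = fun i => (sigmaVec p i : ℝ) := by
    have h2 : (fun i => (sigmaVec p i : ℝ) / (mOf p : ℝ)) =
        (1 / (mOf p : ℝ)) • fun i => (sigmaVec p i : ℝ) := by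
      funext i
      simp [div_eq_inv_mul]
    rw [h2, eq_comm]
    exact (smul_right_injective (Fin ℓ → ℝ) (one_div_ne_zero hm)).eq_iff
  have h0 : sigmaLabels p 0 = mOf p -
      (sigmaVec p ⟨0, by omega⟩ + sigmaVec p ⟨1, by omega⟩) := by
    simp [sigmaLabels, sigmaVec]
  rw [h1]
  constructor
  · rintro ⟨h2, h3⟩
    rw [sum_mark_eq_iff hl h2] at h3
    rw [sum_smul_coweight_eq_iff hl] at h2
    funext k
    induction k using Fin.cases with
    | zero => rw [h0, h3]
    | succ k =>
      have := h2 k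
      rw [← sigmaLabels_succ (by omega)] at this
      exact_mod_cast this
  · rintro rfl
    have h2 := (sum_smul_coweight_eq_iff hl (fun k => (sigmaLabels p k.succ : ℝ))
      fun i => (sigmaVec p i : ℝ)).2 (sigmaLabels_succ (by omega) p)
    exact ⟨h2, (sum_mark_eq_iff hl h2).2 h0⟩

theorem sigmaLabels_nonneg {ℓ : ℕ} (hl : 2 ≤ ℓ) (p : Nat.Partition ℓ) (hp : Even p.parts.card)
    (k : Fin (ℓ + 1)) : 0 ≤ sigmaLabels p k := by
  have hb := sigmaVec_bounds p hp
  induction k using Fin.cases with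
  | zero =>
    have h0 : sigmaLabels p 0 = mOf p -
        (sigmaVec p ⟨0, by omega⟩ + sigmaVec p ⟨1, by omega⟩) := by
      simp [sigmaLabels, sigmaVec]
    have h1 := hb ⟨0, by omega⟩
    have h2 := hb ⟨1, by omega⟩
    omega
  | succ k =>
    have h := sigmaLabels_succ hl p k
    rw [simpleRoot_dotProduct] at h
    split_ifs at h with hk
    · have h1 : sigmaVec p ⟨k + 1, hk⟩ ≤ sigmaVec p k :=
        sigmaVec_antitone p (by simp [Fin.le_def])
      have h2 : sigmaLabels p k.succ = sigmaVec p k - sigmaVec p ⟨k + 1, hk⟩ := by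
        exact_mod_cast h
      omega
    · have h1 := hb k
      have h2 := hb ⟨k - 1, by omega⟩
      have h3 : sigmaLabels p k.succ = sigmaVec p ⟨k - 1, by omega⟩ + sigmaVec p k := by
        exact_mod_cast h
      omega

/-! ### Conjugation into the torus -/

theorem antiDiag_mul_transpose_cochar {ℓ : ℕ} (lam : Fin ℓ → ℤ) {z : ℂ} (hz : z ≠ 0) :
    antiDiag (2 * ℓ) * (cochar lam z)ᵀ * antiDiag (2 * ℓ) * cochar lam z = 1 := by
  rw [cochar, diagonal_transpose]
  set d : Fin (2 * ℓ) → ℂ := fun i =>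
    if h : (i : ℕ) < ℓ then z ^ lam ⟨i, h⟩ else z ^ (-lam ⟨2 * ℓ - 1 - i, by omega⟩) with hd
  have h1 : antiDiag (2 * ℓ) * diagonal d = diagonal (fun i => d i.rev) * antiDiag (2 * ℓ) := by
    ext i j
    rw [mul_diagonal, diagonal_mul, antiDiag, Matrix.of_apply]
    split_ifs with h
    · rw [h, one_mul, mul_one]
    · rw [zero_mul, mul_zero]
  rw [h1, mul_assoc (diagonal _), antiDiag_mul_self, mul_one, diagonal_mul_diagonal,
    ← diagonal_one]
  congr 1
  funext i
  have hi := i.isLt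
  have hrev : ((i.rev : Fin (2 * ℓ)) : ℕ) = 2 * ℓ - 1 - i := by rw [Fin.val_rev]; omega
  simp only [hd]
  by_cases h : (i : ℕ) < ℓ
  · rw [dif_pos h, dif_neg (by omega)]
    have : (⟨2 * ℓ - 1 - (i.rev : Fin (2 * ℓ)), by omega⟩ : Fin ℓ) = ⟨i, h⟩ := by
      rw [Fin.mk.injEq]; omega
    rw [this, ← zpow_add₀ hz, neg_add_cancel, zpow_zero]
  · rw [dif_neg h, dif_pos (by omega)]
    have : (⟨(i.rev : Fin (2 * ℓ)), by omega⟩ : Fin ℓ) = ⟨2 * ℓ - 1 - i, by omega⟩ := by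
      rw [Fin.mk.injEq]; omega
    rw [this, ← zpow_add₀ hz, add_neg_cancel, zpow_zero]

/-- If the last coordinate of `lam` vanishes, then `lam(z)` commutes with an element of the full
orthogonal group of determinant `-1`. -/
theorem exists_reflection_commute_cochar {ℓ : ℕ} (hl : 0 < ℓ) {lam : Fin ℓ → ℤ}
    (h : lam ⟨ℓ - 1, by omega⟩ = 0) (z : ℂ) : ∃ T : Matrix (Fin (2 * ℓ)) (Fin (2 * ℓ)) ℂ,
      antiDiag (2 * ℓ) * Tᵀ * antiDiag (2 * ℓ) * T = 1 ∧ T.det = -1 ∧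
      cochar lam z * T = T * cochar lam z := by
  -- The two middle basis vectors are exchanged by the reversal, and $\lambda(z)$ acts on both by
  -- $z^{\pm\lambda_\ell}=1$.
  let x : Fin (2 * ℓ) := ⟨ℓ - 1, by omega⟩
  let y : Fin (2 * ℓ) := ⟨ℓ, by omega⟩
  have hxy : x ≠ y := by simp only [x, y, Ne, Fin.mk.injEq]; omega
  have hxr : x.rev = y := by rw [Fin.ext_iff, Fin.val_rev]; simp only [x, y]; omega
  have hyr : y.rev = x := by rw [← hxr, Fin.rev_rev]
  refine ⟨(Equiv.swap x y).permMatrix ℂ, antiDiag_mul_transpose_permMatrix fun i => ?_, ?_, ?_⟩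
  · rw [swap_apply_rev, hxr, hyr, Equiv.swap_comm]
  · rw [det_permutation, Equiv.Perm.sign_swap hxy]
    simp
  · rw [cochar]
    set d : Fin (2 * ℓ) → ℂ := fun i =>
      if h : (i : ℕ) < ℓ then z ^ lam ⟨i, h⟩ else z ^ (-lam ⟨2 * ℓ - 1 - i, by omega⟩) with hd
    have hdx : d x = 1 := by
      simp only [hd, x]
      rw [dif_pos (by omega), h, zpow_zero]
    have hdy : d y = 1 := by
      simp only [hd, y]
      rw [dif_neg (by omega)]
      have : (⟨2 * ℓ - 1 - ℓ, by omega⟩ : Fin ℓ) = ⟨ℓ - 1, by omega⟩ := by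
        rw [Fin.mk.injEq]; omega
      rw [this, h, neg_zero, zpow_zero]
    ext i j
    rw [diagonal_mul, mul_diagonal, permMatrix_apply]
    split_ifs with hij
    · rw [one_mul, mul_one, ← hij]
      rcases eq_or_ne i x with rfl | hix
      · rw [Equiv.swap_apply_left, hdx, hdy]
      rcases eq_or_ne i y with rfl | hiy
      · rw [Equiv.swap_apply_right, hdx, hdy]
      rw [Equiv.swap_apply_of_ne_of_ne hix hiy]
    · rw [zero_mul, mul_zero]

/-- Equal spectra give conjugacy in the full orthogonal group. In $\mathrm{SO}_{2\ell}$ this class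
could split in two; the reflection centralizing $\lambda(z)$ prevents it. -/
theorem exists_mem_SO_conj_cochar {ℓ : ℕ} (hl : 0 < ℓ) {g : Matrix (Fin (2 * ℓ)) (Fin (2 * ℓ)) ℂ}
    (hg : g ∈ SO ℓ) (hfin : IsOfFinOrder g) {lam : Fin ℓ → ℤ} (h : lam ⟨ℓ - 1, by omega⟩ = 0)
    {z : ℂ} (hz : z ≠ 0) (hchar : g.charpoly = (cochar lam z).charpoly) :
    ∃ k ∈ SO ℓ, k⁻¹ * g * k = cochar lam z := by
  obtain ⟨P, hP, hgP⟩ := exists_mul_eq_mul_diagonal_of_charpoly_eq hfin.orderOf_pos.ne'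
    (pow_orderOf_eq_one g) hchar
  have hKT := antiDiag_transpose (2 * ℓ)
  have hKK := antiDiag_mul_self (2 * ℓ)
  obtain ⟨k, hk, hgk⟩ := exists_orthogonal_conj hKT hKK ((mem_SO_iff g).1 hg).1
    (antiDiag_mul_transpose_cochar lam hz) hP hgP
  have hconj : ∀ k, k ∈ SO ℓ → g * k = k * cochar lam z → k⁻¹ * g * k = cochar lam z := by
    intro k hk h
    rw [mul_assoc, h, ← mul_assoc, nonsing_inv_mul _ (by
      rw [((mem_SO_iff k).1 hk).2]; exact isUnit_one), one_mul]
  have hKdet : (antiDiag (2 * ℓ)).det * (antiDiag (2 * ℓ)).det = 1 := by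
    rw [← det_mul, hKK, det_one]
  have hkdet : k.det = 1 ∨ k.det = -1 := by
    have h1 := congrArg det hk
    rw [det_mul, det_mul, det_mul, det_transpose, det_one] at h1
    rw [← sub_eq_zero, ← sub_eq_zero (b := (-1 : ℂ)), ← mul_eq_zero]
    linear_combination h1 - k.det ^ 2 * hKdet
  rcases hkdet with hdet | hdet
  · have hkSO := (mem_SO_iff k).2 ⟨hk, hdet⟩
    exact ⟨k, hkSO, hconj k hkSO hgk⟩
  · obtain ⟨T, hT1, hT2, hT3⟩ := exists_reflection_commute_cochar hl h z
    have hkT : k * T ∈ SO ℓ := by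
      refine (mem_SO_iff _).2 ⟨?_, ?_⟩
      · have h1 : kᵀ * antiDiag (2 * ℓ) * k = antiDiag (2 * ℓ) := by
          calc kᵀ * antiDiag (2 * ℓ) * k = antiDiag (2 * ℓ) * antiDiag (2 * ℓ) *
                (kᵀ * antiDiag (2 * ℓ) * k) := by rw [hKK, one_mul]
            _ = antiDiag (2 * ℓ) * (antiDiag (2 * ℓ) * kᵀ * antiDiag (2 * ℓ) * k) := by
                simp only [mul_assoc]
            _ = _ := by rw [hk, mul_one]
        rw [transpose_mul]
        calc antiDiag (2 * ℓ) * (Tᵀ * kᵀ) * antiDiag (2 * ℓ) * (k * T) =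
            antiDiag (2 * ℓ) * Tᵀ * (kᵀ * antiDiag (2 * ℓ) * k) * T := by simp only [mul_assoc]
          _ = 1 := by rw [h1, hT1]
      · rw [det_mul, hdet, hT2, neg_mul_neg, one_mul]
    refine ⟨k * T, hkT, hconj _ hkT ?_⟩
    rw [← mul_assoc, hgk, mul_assoc, hT3, mul_assoc]

/-! ### Existence and uniqueness of the Kac diagram -/

theorem sigmaVec_last {ℓ : ℕ} (hl : 0 < ℓ) (p : Nat.Partition ℓ) (hp : Even p.parts.card) :
    sigmaVec p ⟨ℓ - 1, by omega⟩ = 0 := by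
  obtain ⟨i, hi⟩ := exists_sigmaVec_eq_zero hl p hp
  have h1 : sigmaVec p ⟨ℓ - 1, by omega⟩ ≤ sigmaVec p i :=
    sigmaVec_antitone p (by rw [Fin.le_def]; dsimp only; omega)
  have h2 := (sigmaVec_bounds p hp ⟨ℓ - 1, by omega⟩).1
  omega

theorem isKacDiagram_nMat_iff {ℓ : ℕ} (hl : 4 ≤ ℓ) (p : Nat.Partition ℓ)
    (hp : Even p.parts.card) {ξ : ℂ} (hξ : IsPrimitiveRoot ξ (mOf p)) (d : Fin (ℓ + 1) → ℤ) :
    IsKacDiagram ξ (nMat p) d ↔ d = reduce (sigmaLabels p) := by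
  have hm := mOf_pos p
  have hmR : (0 : ℝ) < mOf p := Nat.cast_pos.2 hm
  have horder := orderOf_nMat (by omega) p
  have hfin : IsOfFinOrder (nMat p) := by
    rw [← orderOf_pos_iff, horder]
    exact hm
  have hchar := charpoly_nMat_eq_cochar p hp hξ
  rw [IsKacDiagram, horder]
  constructor
  · rintro ⟨-, -, -, k, hk, lam, x, s, hconj, hx, hxC, -, hxs, hms, rfl⟩
    have hkdet : IsUnit k.det := by rw [((mem_SO_iff k).1 hk).2]; exact isUnit_one
    have hlam : lam = sigmaVec p := by
      refine eq_sigmaVec hl p hp hξ ?_ ?_ ?_ ?_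
      · rw [← hchar, ← hconj, charpoly_mul_comm, ← mul_assoc, mul_nonsing_inv _ hkdet, one_mul]
      -- Multiplied by $m$, the inequalities of the closed alcove are the three conditions on `lam`.
      all_goals
        intro i j hij
        have h1 := (mem_closure_alcove_iff x).1 hxC i j hij
        rw [hx, hx, ← sub_div, ← add_div, div_le_one hmR, div_le_one hmR, le_div_iff₀ hmR,
          le_div_iff₀ hmR, zero_mul] at h1
        norm_cast at h1
        omega
    subst hlam
    obtain rfl : x = fun i => (sigmaVec p i : ℝ) / (mOf p : ℝ) := funext hx
    rw [(eq_sigmaLabels_iff hl p s).1 ⟨hxs, hms⟩]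
  · rintro rfl
    obtain ⟨k, hk, hconj⟩ := exists_mem_SO_conj_cochar (by omega) (nMat_mem_SO p hp) hfin
      (sigmaVec_last (by omega) p hp) (hξ.ne_zero hm.ne') hchar
    obtain ⟨h1, h2⟩ := (eq_sigmaLabels_iff hl p _).2 rfl
    refine ⟨nMat_mem_SO p hp, hfin, hξ, k, hk, sigmaVec p, _, sigmaLabels p, hconj, fun _ => rfl,
      ?_, sigmaLabels_nonneg (by omega) p hp, h1, h2, rfl⟩
    rw [mem_closure_alcove_iff]
    intro i j hij
    rw [← sub_div, ← add_div, div_le_one hmR, div_le_one hmR, le_div_iff₀ hmR, le_div_iff₀ hmR,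
      zero_mul]
    norm_cast
    have h3 := sigmaVec_bounds p hp i
    have h4 := sigmaVec_bounds p hp j
    have h5 := sigmaVec_antitone p hij.le
    omega

end KacD

/-- The Kac diagram of the element `n` of `SO_{2ℓ}` attached to a partition of `ℓ ≥ 4` with an even
number of parts. -/
theorem mainTheorem7 (ℓ : ℕ) (hl : 4 ≤ ℓ) (p : Nat.Partition ℓ) (hp : Even p.parts.card) :
    KacD.nMat p ∈ KacD.SO ℓ ∧ IsOfFinOrder (KacD.nMat p) ∧
    ∀ ξ : ℂ, IsPrimitiveRoot ξ (orderOf (KacD.nMat p)) →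
      ∀ d : Fin (ℓ + 1) → ℤ,
        KacD.IsKacDiagram ξ (KacD.nMat p) d ↔ d = KacD.reduce (KacD.sigmaLabels p) := by
  have horder := KacD.orderOf_nMat (by omega) p
  refine ⟨KacD.nMat_mem_SO p hp, ?_, fun ξ hξ d => ?_⟩
  · rw [← orderOf_pos_iff, horder]
    exact KacD.mOf_pos p
  · rw [horder] at hξ
    exact KacD.isKacDiagram_nMat_iff hl p hp hξ d
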